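/- Let $S=\{a_n\}_{n\in\mathbb N}\subset\mathbb C$ satisfy $0<|a_1|\le|a_2|\le\dots\to\infty$, let its exponent of convergence $\alpha=\limsup_{n\to\infty}\frac{\ln n}{\ln|a_n|}$ be finite, and let $\varepsilon>0$, $\Psi\in[-\pi,\pi)$ be such that no $a_n$ lies in the open sector $\Sigma=\{re^{i\theta}: r>0,\ |\theta-\Psi|<\varepsilon\}$. Put $\zeta_S(s)=\sum_{n\ge1}a_n^{-s}$ for $\operatorname{Re}s>\alpha$ (an absolutely convergent series), where $a_n^{-s}=e^{-s\ln a_n}$ with $\operatorname{Im}\ln a_n\in(\Psi-2\pi,\Psi)$. Let $F$ be a characteristic function of $S$ of minimal order: $F$ is entire, its zeros are the $a_n$ counted with multiplicity, and its order of growth is at most $\alpha$. Assume that some holomorphic branch of $\ln F$ on $\Sigma$ satisfies $$\ln F(z)=\sum_{j=0}^N\sum_{k=0}^M d_{j,k}\,z^{\alpha-j/m}\ln^k z+o\big(z^{\alpha-N/m-\delta}\big),\qquad z\to\infty,\ z\in\Sigma,$$ for some integers $m\ge1$, $M,N\ge0$, some $\delta>0$ with $N/m>\alpha-\delta$, and $d_{j,k}\in\mathbb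 C$; here $\ln z$ is the branch on $\Sigma$ with $\ln(te^{i\Psi})=\ln t+i\Psi$ for $t>0$, and $z^{\beta}=e^{\beta\ln z}$. Then $\zeta_S$ extends to a meromorphic function on the half-plane $\operatorname{Re}s>\alpha-N/m-\delta$ (which contains $0$). It is regular at every point of this half-plane except possibly at those points $\alpha-j/m$, $0\le j\le N$, for which some $d_{j,k}$, $0\le k\le M$, is nonzero. For such a $j$ let $\bar k=\max\{k\in\{0,\dots,M\}: d_{j,k}\neq0\}$. Then, a pole of order $0$ being a regular point: 1. if $\alpha-j/m\notin\mathbb Z$, then $\alpha-j/m$ is a pole of order exactly $\bar k+1$; 2. if $\alpha-j/m\in\mathbb Z\setminus\{0\}$, then $\alpha-j/m$ is a pole of order exactly $\bar k$. Moreover: 3. if $M\in\{0,1\}$, then $s=0$ is a regular point; $\zeta_S(0)=0$ if $\alpha-j/m\ne0$ for all $j\in\{0,\dots,N\}$, and $\zeta_S(0)=d_{j',1}$ if $\alpha-j'/m=0$ for some $j'\in\{0,\dots,N\}$ (where $d_{j',1}:=0$ if $M=0$); 4. if $M\ge2$, then $s=0$ is a pole of order at most $M-1$, and it is a pole of order exactly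 $M-1$ if $\alpha-j'/m=0$ for some $j'\in\{0,\dots,N\}$ with $d_{j',M}\ne0$. -/

import Mathlib

open Filter Asymptotics Topology Bornology

noncomputable section

namespace SeqZeta

/-- The open sector of half-opening `ε` around the ray `{t e^{iΨ} : t > 0}`:
the points `r e^{iθ}` with `r > 0` and `θ ∈ (Ψ - ε, Ψ + ε)` modulo `2π` (for `ε ≤ π`). -/
def sector (Ψ ε : ℝ) : Set ℂ :=
  {z | z ≠ 0 ∧ |Complex.arg (z * Complex.exp (-(Ψ : ℂ) * Complex.I))| < ε}

/-- The sequence `a 0, a 1, …` (that is `a₁, a₂, …`) is nonzero, ordered by modulus and tends to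
infinity, has (finite) exponent of convergence `α`, and avoids the sector of half-opening `ε > 0`
around the ray of direction `Ψ`. -/
structure IsZetaSequence (a : ℕ → ℂ) (α Ψ ε : ℝ) : Prop where
  pos : 0 < ‖a 0‖
  mono : Monotone fun n => ‖a n‖
  tendsto : Tendsto (fun n => ‖a n‖) atTop atTop
  exponent : limsup (fun n : ℕ => ((Real.log ((n : ℝ) + 1) / Real.log ‖a n‖ : ℝ) : EReal)) atTop
    = (α : EReal)
  angle_mem : Ψ ∈ Set.Ico (-Real.pi) Real.pi
  eps_pos : 0 < ε
  avoids : ∀ n, a n ∉ sector Ψ ε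

/-- The logarithm with branch cut on the ray `{t e^{iΨ} : t ≥ 0}`: imaginary part in
`(Ψ - 2π, Ψ)` off the cut. -/
def cutLog (Ψ : ℝ) (z : ℂ) : ℂ :=
  Complex.log (-(z * Complex.exp (-(Ψ : ℂ) * Complex.I))) + ((Ψ - Real.pi : ℝ) : ℂ) * Complex.I

/-- The branch of the logarithm near the ray of direction `Ψ`, with
`log (t e^{iΨ}) = log t + iΨ`: imaginary part in `(Ψ - π, Ψ + π]`. -/
def rayLog (Ψ : ℝ) (z : ℂ) : ℂ :=
  Complex.log (z * Complex.exp (-(Ψ : ℂ) * Complex.I)) + (Ψ : ℂ) * Complex.I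

/-- The term `w ^ (-s)`, with branch cut on the ray of direction `Ψ`. -/
def zetaTerm (Ψ : ℝ) (s w : ℂ) : ℂ := Complex.exp (-s * cutLog Ψ w)

/-- The zeta series `∑ aₙ ^ (-s)`. -/
def zetaSeries (a : ℕ → ℂ) (Ψ : ℝ) (s : ℂ) : ℂ := ∑' n, zetaTerm Ψ s (a n)

/-- The order of growth of a function on `ℂ`: the infimum of all `ρ ≥ 0` with
`F(z) = O(exp(|z|^ρ))` as `z → ∞`. -/
def growthOrder (F : ℂ → ℂ) : ENNReal :=
  ⨅ (ρ : NNReal) (_ : F =O[cobounded ℂ] fun z => Real.exp (‖z‖ ^ (ρ : ℝ))), (ρ : ENNReal)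

/-- `F` is a characteristic function of the sequence `a` of minimal order: it is entire, its zeros
are the terms of `a` counted with multiplicity, and its order of growth does not exceed the
exponent of convergence `α` of `a` (the smallest order that such a function can have). -/
structure IsCharacteristicFunction (F : ℂ → ℂ) (a : ℕ → ℂ) (α : ℝ) : Prop where
  entire : Differentiable ℂ F
  zeros : ∀ w, analyticOrderAt F w = Set.encard {n | a n = w}
  order_le : growthOrder F ≤ ENNReal.ofReal α

/-- The exponents `α - j / m` of the expansion. -/
def expo (α : ℝ) (m j : ℕ) : ℝ := α - (j : ℝ) / (m : ℝ)

/-- Some holomorphic branch of `log F` in the sector around the ray of direction `Ψ` equals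
`∑_{j ≤ N} ∑_{k ≤ M} d_{j,k} z^{α - j/m} (log z)^k + o(z^{α - N/m - δ})` as `z → ∞` there. -/
def HasLogExpansion (F : ℂ → ℂ) (α Ψ ε : ℝ) (m M N : ℕ) (δ : ℝ) (d : ℕ → ℕ → ℂ) : Prop :=
  ∃ L : ℂ → ℂ, DifferentiableOn ℂ L (sector Ψ ε) ∧
    (∀ z ∈ sector Ψ ε, Complex.exp (L z) = F z) ∧
    (fun z => L z - ∑ j ∈ Finset.range (N + 1), ∑ k ∈ Finset.range (M + 1),
        d j k * Complex.exp ((expo α m j : ℂ) * rayLog Ψ z) * rayLog Ψ z ^ k)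
      =o[cobounded ℂ ⊓ 𝓟 (sector Ψ ε)] fun z => ‖z‖ ^ (expo α m N - δ)

/-- `f` has a pole of order `n` at `s`, where a pole of order `0` is a regular point. -/
def HasPoleOfOrder (f : ℂ → ℂ) (s : ℂ) (n : ℕ) : Prop :=
  if n = 0 then AnalyticAt ℂ f s else meromorphicOrderAt f s = ((-(n : ℤ) : ℤ) : WithTop ℤ)

end SeqZeta

end

/-! Rotate by `Ψ` and change sign: `b n = -a n · e^{-iΨ}` stays at angle at least `ε` from the
negative axis, and `F(w e^{iΨ})` has the zeros `-b n`. Write `f` for the logarithm of the rotated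
function and fix an integer `p > α`. On the positive axis the derivative of order `p + 1` of `f` is
`∑ (-1)^p p! (t + b n)^{-(p+1)}`. No Hadamard product is needed: the first `K` zeros are divided
out, and Borel–Carathéodory with Cauchy's estimate shows that what remains tends to `0`, since the
growth exponent is below `p + 1` (`tendsto_sum_iteratedDeriv_log`).

By the Beta integral, the Mellin transform of `(t + b)^{-(p+1)}` at `p + 1 - s` is `b^{-s} Γ(s)
Γ(p+1-s) / p!` (`integral_cpow_mul_inv_pow`). Hence, up to the sign `(-1)^p`, `Γ(s) Γ(p+1-s) ∑ b
n^{-s}` is the Mellin transform of `f^{(p+1)}`. The expansion of `f` may be differentiated by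
Cauchy's estimate on circles of radius proportional to `t`. A term `w^β Q(log w)` becomes `w^{β-p-1}
P(log w)` with `P = ∏_{i ≤ p} (D + β - i) Q`, where `D` is differentiation. The Mellin transform of
such a term, cut off to `t > 1`, is the polar part `∑ k! P_k / (s - β)^{k+1}`, and the remainder has
a holomorphic transform in a strip reaching left of `0` (`exists_mellin_continuation`,
`exists_continuation`).

The pole orders come from two effects. If `β` is one of `0, …, p`, a factor of the operator is `D`
itself and the degree of `Q` drops by exactly one; otherwise it is kept. Division by `Γ(s)` removes
one order at `0, -1, -2, …`. So nothing is lost at a non-integer exponent, one order at a nonzero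
integer, and two at `0`, where for `M ≤ 1` a finite value remains. -/

namespace SeqZeta

/-! ### High derivatives of the logarithm of an entire function as sums over its zeros. -/

section Hadamard

/-- Dividing an entire function by one of its zeros. -/
lemma exists_entire_factor_one {F : ℂ → ℂ} (hF : Differentiable ℂ F) {b : ℂ} (hb : b ≠ 0)
    (h0 : F (-b) = 0) :
    ∃ G : ℂ → ℂ, Differentiable ℂ G ∧ (∀ z, F z = (1 + z / b) * G z) ∧
      ∀ w, analyticOrderAt F w = (if -b = w then 1 else 0) + analyticOrderAt G w := by
  have hd : Differentiable ℂ (dslope F (-b)) := by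
    rw [← differentiableOn_univ]
    exact (Complex.differentiableOn_dslope univ_mem).2 hF.differentiableOn
  -- The factor `b` makes this the quotient by `1 + z / b`, which is `1` at `0`; so every quotient
  -- keeps the value `F 0`.
  have hG : Differentiable ℂ fun z => b * dslope F (-b) z := hd.const_mul b
  have hfac : ∀ z, F z = (1 + z / b) * (b * dslope F (-b) z) := by
    intro z
    have h := sub_smul_dslope F (-b) z
    rw [h0, sub_zero, smul_eq_mul] at h
    rw [← h]
    field_simp
    ring
  refine ⟨_, hG, hfac, fun w => ?_⟩
  have hlin : AnalyticAt ℂ (fun z : ℂ => 1 + z / b) w := by fun_prop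
  have hmul : analyticOrderAt F w = analyticOrderAt (fun z : ℂ => 1 + z / b) w +
      analyticOrderAt (fun z => b * dslope F (-b) z) w := by
    rw [← analyticOrderAt_mul hlin (hG.analyticAt w)]
    exact congrArg (analyticOrderAt · w) (funext hfac)
  rw [hmul]
  congr 1
  split_ifs with h
  · apply hlin.analyticOrderAt_eq_one_of_zero_deriv_ne_zero
    · rw [← h]; field_simp; ring
    · have : HasDerivAt (fun z : ℂ => 1 + z / b) (1 / b) w :=
        ((hasDerivAt_id w).div_const b).const_add 1
      rw [this.deriv]
      exact one_div_ne_zero hb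
  · rw [hlin.analyticOrderAt_eq_zero]
    intro h'
    apply h
    field_simp at h'
    linear_combination -h'

/-- Matches the drop of multiplicities when a single zero is divided out. -/
lemma encard_setOf_shift (b : ℕ → ℂ) (K : ℕ) (w : ℂ) :
    Set.encard {n | -b (n + K) = w} =
      (if -b K = w then 1 else 0) + Set.encard {n | -b (n + (K + 1)) = w} := by
  have himg : (fun n => n + 1) '' {n | -b (n + (K + 1)) = w} = {n | -b (n + K) = w} \ {0} := by
    ext n
    simp only [Set.mem_image, Set.mem_ofPred_eq, Set.mem_sdiff, Set.mem_singleton_iff]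
    constructor
    · rintro ⟨x, hx, rfl⟩
      exact ⟨by rw [← hx]; congr 2; ring, by omega⟩
    · rintro ⟨hn, h0⟩
      exact ⟨n - 1, by rw [← hn]; congr 2; omega, by omega⟩
  have hinj : Set.encard {n | -b (n + (K + 1)) = w} = Set.encard ({n | -b (n + K) = w} \ {0}) := by
    rw [← himg, Function.Injective.encard_image (fun x y h => by simpa using h)]
  rw [hinj]
  split_ifs with h
  · rw [add_comm, Set.encard_sdiff_singleton_add_one (by simpa using h)]
  · rw [zero_add, Set.sdiff_singleton_eq_self (by simpa using h)]

/-- Dividing an entire function by the first `K` of its zeros `-b 0, -b 1, …`. -/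
lemma exists_entire_factor {F : ℂ → ℂ} (hF : Differentiable ℂ F) {b : ℕ → ℂ} (hb : ∀ n, b n ≠ 0)
    (hz : ∀ w, analyticOrderAt F w = Set.encard {n | -b n = w}) (K : ℕ) :
    ∃ G : ℂ → ℂ, Differentiable ℂ G ∧
      (∀ z, F z = (∏ n ∈ Finset.range K, (1 + z / b n)) * G z) ∧
      ∀ w, analyticOrderAt G w = Set.encard {n | -b (n + K) = w} := by
  induction K with
  | zero => exact ⟨F, hF, by simp, by simpa using hz⟩
  | succ K ih =>
    obtain ⟨G, hG, hFG, hord⟩ := ih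
    have h0 : G (-b K) = 0 := by
      apply apply_eq_zero_of_analyticOrderAt_ne_zero
      rw [hord, Set.encard_ne_zero]
      exact ⟨0, by simp⟩
    obtain ⟨G', hG', hGG', hord'⟩ := exists_entire_factor_one hG (hb K) h0
    refine ⟨G', hG', fun z => ?_, fun w => ?_⟩
    · rw [hFG, hGG', Finset.prod_range_succ, mul_assoc]
    · have h := hord' w
      rw [hord w, encard_setOf_shift] at h
      split_ifs at h
      · exact (ENat.add_right_injective_of_ne_top (by simp) h).symm
      · simpa using h.symm

/-- A zero free entire function has a logarithm on a ball; its derivatives are controlled by the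
maximum modulus. -/
lemma exists_log_ball {G : ℂ → ℂ} (hG : Differentiable ℂ G) {R M : ℝ} (hR : 0 < R) (hM : 0 < M)
    (h0 : ∀ z ∈ Metric.ball (0 : ℂ) R, G z ≠ 0)
    (hbd : ∀ z ∈ Metric.ball (0 : ℂ) R, ‖G z‖ ≤ Real.exp M) :
    ∃ l : ℂ → ℂ, DifferentiableOn ℂ l (Metric.ball 0 R) ∧
      (∀ z ∈ Metric.ball (0 : ℂ) R, deriv l z = logDeriv G z) ∧
      ∀ (q : ℕ) (z : ℂ), ‖z‖ ≤ R / 4 → ‖iteratedDeriv q l z‖ ≤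
        q.factorial * (2 * M + 3 * ‖Complex.log (G 0)‖) / (R / 4) ^ q := by
  have hdl : DifferentiableOn ℂ (logDeriv G) (Metric.ball 0 R) := by
    intro z hz
    exact ((hG.deriv z).div (hG z) (h0 z hz)).differentiableWithinAt
  obtain ⟨l, hl0, hl⟩ := (hdl.isExactOn_ball).with_val_at 0 (Complex.log (G 0))
  have hld : DifferentiableOn ℂ l (Metric.ball 0 R) := fun z hz =>
    (hl z hz).differentiableAt.differentiableWithinAt
  have hmem0 : (0 : ℂ) ∈ Metric.ball (0 : ℂ) R := Metric.mem_ball_self hR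
  have hexp : ∀ z ∈ Metric.ball (0 : ℂ) R, Complex.exp (l z) = G z := by
    -- As `l' = G' / G`, the function `G e^{-l}` has derivative zero.
    have key : ∀ z ∈ Metric.ball (0 : ℂ) R, G z * Complex.exp (-l z) =
        G 0 * Complex.exp (-l 0) := by
      intro z hz
      refine Metric.isOpen_ball.is_const_of_deriv_eq_zero
        (convex_ball (0 : ℂ) R).isPreconnected (f := fun z => G z * Complex.exp (-l z))
        (hG.differentiableOn.mul (hld.neg.cexp)) ?_ hz hmem0
      intro w hw
      have h1 := (hG w).hasDerivAt.mul (((hl w hw).neg).cexp)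
      have h2 : deriv (fun z => G z * Complex.exp (-l z)) w = _ := h1.deriv
      rw [h2, logDeriv_apply]
      have := h0 w hw
      simp only [Pi.zero_apply, Pi.neg_apply]
      field_simp
      ring
    intro z hz
    have h := key z hz
    rw [hl0, Complex.exp_neg, Complex.exp_neg, Complex.exp_log (h0 0 hmem0),
      mul_inv_cancel₀ (h0 0 hmem0)] at h
    have := Complex.exp_ne_zero (l z)
    field_simp at h
    exact h.symm
  refine ⟨l, hld, fun z hz => (hl z hz).deriv, fun q z hz => ?_⟩
  have hre : Set.MapsTo l (Metric.ball 0 R) {z | z.re ≤ M} := by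
    intro z hz
    have h := hbd z hz
    rw [← hexp z hz, Complex.norm_exp, Real.exp_le_exp] at h
    exact h
  have hsub : Metric.closedBall z (R / 4) ⊆ Metric.ball 0 R := by
    intro w hw
    rw [mem_ball_zero_iff]
    rw [mem_closedBall_iff_norm] at hw
    have := norm_add_le (w - z) z
    rw [sub_add_cancel] at this
    linarith
  refine Complex.norm_iteratedDeriv_le_of_forall_mem_sphere_norm_le q (by positivity) ?_ ?_
  · refine (hld.mono ?_).diffContOnCl
    rwa [closure_ball _ (by positivity)]
  · intro w hw
    have hw' := hsub (Metric.sphere_subset_closedBall hw)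
    have hn : ‖w‖ ≤ R / 2 := by
      rw [mem_sphere_iff_norm] at hw
      have := norm_add_le (w - z) z
      rw [sub_add_cancel] at this
      linarith
    -- For `‖w‖ ≤ R / 2` the quotients `‖w‖ / (R - ‖w‖)` and `(R + ‖w‖) / (R - ‖w‖)` are at most `1`
    -- and `3`, whence `2 M + 3 ‖log (G 0)‖`.
    have h := Complex.borelCaratheodory hM hld hre hR hw'
    rw [hl0] at h
    refine h.trans ?_
    have hden : 0 < R - ‖w‖ := by linarith
    rw [← add_div, div_le_iff₀ hden]
    have := norm_nonneg (Complex.log (G 0))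
    nlinarith [norm_nonneg w]

/-- For a zero free function `G` with `F = G ∏_{n < K} (1 + z / b n)`, the maximum modulus principle
bounds `G` on a ball of radius at least all `‖b n‖`, `n < K`, by the size of `F` on the circle of
twice the radius. -/
lemma norm_factor_le {F G : ℂ → ℂ} (hG : Differentiable ℂ G) {b : ℕ → ℂ} (hb : ∀ n, b n ≠ 0)
    {K : ℕ} (hFG : ∀ z, F z = (∏ n ∈ Finset.range K, (1 + z / b n)) * G z) {R C : ℝ} (hR : 0 < R)
    (hbR : ∀ n < K, ‖b n‖ ≤ R) (hC : ∀ z, ‖z‖ = 2 * R → ‖F z‖ ≤ C) {z : ℂ}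
    (hz : z ∈ Metric.ball (0 : ℂ) R) : ‖G z‖ ≤ C := by
  refine Complex.norm_le_of_forall_mem_frontier_norm_le (U := Metric.ball (0 : ℂ) (2 * R))
    Metric.isBounded_ball hG.diffContOnCl (fun w hw => ?_)
    (subset_closure (Metric.ball_subset_ball (by linarith) hz))
  rw [frontier_ball _ (by positivity), mem_sphere_zero_iff_norm] at hw
  -- On the circle of radius `2R` each `w / b n` has modulus at least `2`, so each factor has
  -- modulus at least `1`.
  have h1 : (1 : ℝ) ≤ ‖∏ n ∈ Finset.range K, (1 + w / b n)‖ := by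
    rw [norm_prod]
    refine Finset.one_le_prod fun n hn => ?_
    have hbn : 0 < ‖b n‖ := norm_pos_iff.2 (hb n)
    have h2 : (2 : ℝ) ≤ ‖w / b n‖ := by
      rw [norm_div, hw, le_div_iff₀ hbn]
      linarith [hbR n (Finset.mem_range.1 hn)]
    have h3 := norm_sub_le (1 + w / b n) 1
    rw [add_sub_cancel_left, norm_one] at h3
    linarith
  have h2 := hC w hw
  rw [hFG, norm_mul] at h2
  nlinarith [norm_nonneg (G w)]

lemma iteratedDeriv_inv_add (p : ℕ) (b z : ℂ) :
    iteratedDeriv p (fun w => (w + b)⁻¹) z = (-1) ^ p * p.factorial * ((z + b) ^ (p + 1))⁻¹ := by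
  have h := congrFun (iter_deriv_inv_linear p 1 b) z
  simp only [one_mul, one_pow, mul_one] at h
  rw [iteratedDeriv_eq_iterate, h, show (-1 - p : ℤ) = -((p + 1 : ℕ) : ℤ) by push_cast; ring,
    zpow_neg, zpow_natCast]

/-- Estimate for the derivative of order `p + 1` of the logarithm of an entire function after the
contribution of its first `K` zeros has been removed. -/
lemma norm_iteratedDeriv_log_sub_le {F : ℂ → ℂ} (hF : Differentiable ℂ F) {b : ℕ → ℂ}
    (hb : ∀ n, b n ≠ 0) (hmono : Monotone fun n => ‖b n‖)
    (hz : ∀ w, analyticOrderAt F w = Set.encard {n | -b n = w}) {U : Set ℂ} (hU : IsOpen U)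
    {f : ℂ → ℂ} (hf : DifferentiableOn ℂ f U) (hexp : ∀ z ∈ U, Complex.exp (f z) = F z)
    {z : ℂ} (hzU : z ∈ U) (p K : ℕ) {M : ℝ} (hM : 0 < M)
    (hzK : ‖z‖ < ‖b K‖ / 4) (hFM : ∀ w, ‖w‖ = 2 * ‖b K‖ → ‖F w‖ ≤ Real.exp M) :
    ‖iteratedDeriv (p + 1) f z -
      ∑ n ∈ Finset.range K, (-1) ^ p * p.factorial * ((z + b n) ^ (p + 1))⁻¹‖ ≤
      (p + 1).factorial * (2 * M + 3 * ‖Complex.log (F 0)‖) / (‖b K‖ / 4) ^ (p + 1) := by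
  obtain ⟨G, hG, hFG, hord⟩ := exists_entire_factor hF hb hz K
  have hR : 0 < ‖b K‖ := norm_pos_iff.2 (hb K)
  have hG0 : ∀ w ∈ Metric.ball (0 : ℂ) ‖b K‖, G w ≠ 0 := by
    intro w hw
    rw [← (hG.analyticAt w).analyticOrderAt_eq_zero, hord, Set.encard_eq_zero,
      Set.eq_empty_iff_forall_notMem]
    intro n hn
    rw [mem_ball_zero_iff] at hw
    have h1 : ‖b K‖ ≤ ‖b (n + K)‖ := hmono (by omega)
    have h2 : ‖b (n + K)‖ = ‖w‖ := by rw [← hn, norm_neg]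
    linarith
  obtain ⟨l, hl, hdl, hbd⟩ := exists_log_ball hG hR hM hG0 fun w hw =>
    norm_factor_le hG hb hFG hR (fun n hn => hmono hn.le) hFM hw
  have hG00 : G 0 = F 0 := by simp [hFG]
  rw [hG00] at hbd
  refine le_trans (le_of_eq ?_) (hbd (p + 1) z hzK.le)
  congr 1
  set V := U ∩ Metric.ball (0 : ℂ) ‖b K‖ with hV
  have hVo : IsOpen V := hU.inter Metric.isOpen_ball
  have hzV : z ∈ V := ⟨hzU, by rw [mem_ball_zero_iff]; linarith⟩
  have hne : ∀ w ∈ V, ∀ n ∈ Finset.range K, 1 + w / b n ≠ 0 := by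
    intro w hw
    have h := Complex.exp_ne_zero (f w)
    rw [hexp w hw.1, hFG] at h
    exact Finset.prod_ne_zero_iff.1 (left_ne_zero_of_mul h)
  have hne' : ∀ w ∈ V, ∀ n ∈ Finset.range K, w + b n ≠ 0 := by
    intro w hw n hn h
    apply hne w hw n hn
    have := hb n
    field_simp
    linear_combination h
  -- The two logarithms need not be compared directly: their first derivatives are logarithmic
  -- derivatives of `F` and `G`, and `p` further differentiations give the claim.
  have hderiv : ∀ w ∈ V, deriv f w = deriv l w + ∑ n ∈ Finset.range K, (w + b n)⁻¹ := by
    intro w hw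
    have h1 : logDeriv F w = deriv f w := by
      have hev : F =ᶠ[𝓝 w] fun w => Complex.exp (f w) := by
        filter_upwards [hU.mem_nhds hw.1] with x hx using (hexp x hx).symm
      rw [(logDeriv_congr_nhds hev).eq_of_nhds, logDeriv_apply,
        ((hf.differentiableAt (hU.mem_nhds hw.1)).hasDerivAt.cexp).deriv]
      field_simp [Complex.exp_ne_zero]
    have h2 : logDeriv F w = ∑ n ∈ Finset.range K, (w + b n)⁻¹ + logDeriv G w := by
      have hFG' : F = fun z => (∏ n ∈ Finset.range K, (1 + z / b n)) * G z := funext hFG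
      rw [hFG', logDeriv_mul w (Finset.prod_ne_zero_iff.2 (hne w hw)) (hG0 w hw.2)
        (by fun_prop) (hG w), logDeriv_prod (hne w hw) (by intros; fun_prop)]
      congr 1
      refine Finset.sum_congr rfl fun n hn => ?_
      have : HasDerivAt (fun z : ℂ => 1 + z / b n) (1 / b n) w :=
        ((hasDerivAt_id w).div_const (b n)).const_add 1
      rw [logDeriv_apply, this.deriv]
      have h3 := hne w hw n hn
      have h4 := hne' w hw n hn
      have := hb n
      have h5 : 1 + w / b n = (w + b n) / b n := by field_simp; ring
      rw [h5]
      field_simp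
    rw [← h1, h2, hdl w hw.2, add_comm]
  have hev : deriv f =ᶠ[𝓝 z] fun w => deriv l w + ∑ n ∈ Finset.range K, (w + b n)⁻¹ := by
    filter_upwards [hVo.mem_nhds hzV] with w hw using hderiv w hw
  have hcl : ContDiffAt ℂ p (deriv l) z :=
    ((hl.deriv Metric.isOpen_ball).analyticAt (Metric.isOpen_ball.mem_nhds hzV.2)).contDiffAt
  have hci : ∀ n ∈ Finset.range K, ContDiffAt ℂ p (fun w => (w + b n)⁻¹) z := fun n hn =>
    ContDiffAt.inv (by fun_prop) (hne' z hzV n hn)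
  rw [iteratedDeriv_succ', hev.iteratedDeriv_eq, iteratedDeriv_fun_add hcl (ContDiffAt.sum hci),
    iteratedDeriv_fun_sum hci, iteratedDeriv_succ']
  simp only [iteratedDeriv_inv_add, add_sub_cancel_right]

/-- The derivatives of sufficiently high order of the logarithm of an entire function of finite
order, as a series over its zeros `-b 0, -b 1, …`. -/
theorem tendsto_sum_iteratedDeriv_log {F : ℂ → ℂ} (hF : Differentiable ℂ F) {b : ℕ → ℂ}
    (hb : ∀ n, b n ≠ 0) (hmono : Monotone fun n => ‖b n‖)
    (hlim : Tendsto (fun n => ‖b n‖) atTop atTop)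
    (hz : ∀ w, analyticOrderAt F w = Set.encard {n | -b n = w}) {U : Set ℂ} (hU : IsOpen U)
    {f : ℂ → ℂ} (hf : DifferentiableOn ℂ f U) (hexp : ∀ z ∈ U, Complex.exp (f z) = F z)
    {z : ℂ} (hzU : z ∈ U) (p : ℕ) {ρ : ℝ} (hρ : ρ < p + 1)
    (hgrowth : F =O[cobounded ℂ] fun z => Real.exp (‖z‖ ^ ρ)) :
    Tendsto (fun K => ∑ n ∈ Finset.range K, (-1) ^ p * p.factorial * ((z + b n) ^ (p + 1))⁻¹)
      atTop (𝓝 (iteratedDeriv (p + 1) f z)) := by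
  obtain ⟨C, hC⟩ := hgrowth.bound
  rw [← comap_norm_atTop, eventually_comap] at hC
  obtain ⟨r, hr⟩ := eventually_atTop.1 hC
  -- Moves the constant of the growth bound into the exponent; the `1` added to `c` below keeps the
  -- exponent positive.
  set c := Real.log (max C 1) with hc
  have hc0 : 0 ≤ c := Real.log_nonneg (le_max_right _ _)
  have hCc : C ≤ Real.exp c := by
    rw [hc, Real.exp_log (by positivity)]
    exact le_max_left _ _
  set A := ‖Complex.log (F 0)‖ with hA
  have hkey : ∀ᶠ K in atTop, ‖iteratedDeriv (p + 1) f z -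
      ∑ n ∈ Finset.range K, (-1) ^ p * p.factorial * ((z + b n) ^ (p + 1))⁻¹‖ ≤
      (p + 1).factorial * (2 * (c + 1 + (2 * ‖b K‖) ^ ρ) + 3 * A) / (‖b K‖ / 4) ^ (p + 1) := by
    filter_upwards [hlim.eventually_gt_atTop (4 * ‖z‖), hlim.eventually_ge_atTop r,
      hlim.eventually_ge_atTop 0] with K h1 h2 h3
    refine norm_iteratedDeriv_log_sub_le hF hb hmono hz hU hf hexp hzU p K (by positivity)
      (by linarith) fun w hw => ?_
    refine (hr (2 * ‖b K‖) (by linarith) w hw).trans ?_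
    rw [Real.norm_of_nonneg (Real.exp_pos _).le, hw, Real.exp_add]
    gcongr
    exact hCc.trans (Real.exp_le_exp.2 (by linarith))
  -- A combination of `x ^ (-(p + 1))` and `x ^ (ρ - (p + 1))`; here `ρ < p + 1` is decisive.
  have hzero : Tendsto (fun x : ℝ =>
      (p + 1).factorial * (2 * (c + 1 + (2 * x) ^ ρ) + 3 * A) / (x / 4) ^ (p + 1))
      atTop (𝓝 0) := by
    have e1 : Tendsto (fun x : ℝ => x ^ (-((p : ℝ) + 1))) atTop (𝓝 0) :=
      tendsto_rpow_neg_atTop (by positivity)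
    have e2 : Tendsto (fun x : ℝ => x ^ (-((p : ℝ) + 1 - ρ))) atTop (𝓝 0) :=
      tendsto_rpow_neg_atTop (by linarith)
    have e3 := (e1.const_mul ((p + 1).factorial * (2 * (c + 1) + 3 * A) * 4 ^ (p + 1))).add
      (e2.const_mul (((p + 1).factorial : ℝ) * 2 * 2 ^ ρ * 4 ^ (p + 1)))
    simp only [mul_zero, add_zero] at e3
    refine e3.congr' ?_
    filter_upwards [eventually_gt_atTop 0] with x hx
    rw [show -((p : ℝ) + 1 - ρ) = ρ + -((p : ℝ) + 1) by ring,
      Real.mul_rpow zero_le_two hx.le, Real.rpow_add hx, div_pow,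
      Real.rpow_neg hx.le, show ((p : ℝ) + 1) = ((p + 1 : ℕ) : ℝ) by push_cast; ring,
      Real.rpow_natCast]
    field_simp
    ring
  rw [tendsto_iff_norm_sub_tendsto_zero]
  refine squeeze_zero' (Eventually.of_forall fun _ => norm_nonneg _) ?_ (hzero.comp hlim)
  filter_upwards [hkey] with K hK
  rw [norm_sub_rev]
  exact hK

end Hadamard

end SeqZeta

namespace SeqZeta

/-! ### The Beta integral and the Mellin transform of `(t + b)⁻¹ ^ q`. -/

section Beta

open MeasureTheory Set

lemma image_div_add_Ioi {r : ℝ} (hr : 0 < r) : (fun t : ℝ => t / (t + r)) '' Ioi 0 = Ioo 0 1 := by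
  ext x
  simp only [mem_image, mem_Ioi, mem_Ioo]
  constructor
  · rintro ⟨t, ht, rfl⟩
    exact ⟨by positivity, by rw [div_lt_one (by positivity)]; linarith⟩
  · rintro ⟨h0, h1⟩
    have h2 : 0 < 1 - x := by linarith
    refine ⟨r * x / (1 - x), by positivity, ?_⟩
    field_simp
    ring

/-- The Beta integral over `(0, ∞)`. -/
lemma integral_cpow_div_add_pow_ofReal {r : ℝ} (hr : 0 < r) {q : ℕ} {u : ℂ} (hu : 0 < u.re)
    (huq : u.re < q) :
    IntegrableOn (fun t : ℝ => (t : ℂ) ^ (u - 1) * (((t : ℂ) + r) ^ q)⁻¹) (Ioi 0) ∧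
    ∫ t in Ioi (0 : ℝ), (t : ℂ) ^ (u - 1) * (((t : ℂ) + r) ^ q)⁻¹ =
      (r : ℂ) ^ (u - q) * (Complex.Gamma u * Complex.Gamma (q - u) / Complex.Gamma q) := by
  set v : ℂ := q - u with hv
  have hv0 : 0 < v.re := by simp [hv]; linarith
  set g : ℝ → ℂ := fun x => (x : ℂ) ^ (u - 1) * (1 - (x : ℂ)) ^ (v - 1) with hg
  have hderiv : ∀ t ∈ Ioi (0 : ℝ),
      HasDerivWithinAt (fun t : ℝ => t / (t + r)) (r / (t + r) ^ 2) (Ioi 0) t := by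
    intro t ht
    have ht' : (0 : ℝ) < t := ht
    have h := (hasDerivAt_id t).div ((hasDerivAt_id t).add_const r) (by simp; positivity)
    refine (h.congr_deriv ?_).hasDerivWithinAt
    simp
  have hinj : InjOn (fun t : ℝ => t / (t + r)) (Ioi 0) := by
    intro x hx y hy h
    have hx' : (0 : ℝ) < x := hx
    have hy' : (0 : ℝ) < y := hy
    simp only at h
    rw [div_eq_div_iff (by positivity) (by positivity)] at h
    nlinarith
  -- With `x = t / (t + r)` one has `1 - x = r / (t + r)`, and the powers of `t + r` add up to `(u -
  -- 1) + (v - 1) + 2 = q`.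
  have hval : ∀ t ∈ Ioi (0 : ℝ), |r / (t + r) ^ 2| • g (t / (t + r)) =
      (r : ℂ) ^ v * ((t : ℂ) ^ (u - 1) * (((t : ℂ) + r) ^ q)⁻¹) := by
    intro t ht
    have ht' : (0 : ℝ) < t := ht
    have htr : 0 < t + r := by positivity
    have htc : (t : ℂ) ≠ 0 := by exact_mod_cast ht'.ne'
    have hrc : (r : ℂ) ≠ 0 := by exact_mod_cast hr.ne'
    have htrc : ((t + r : ℝ) : ℂ) ≠ 0 := by exact_mod_cast htr.ne'
    have h1 : (1 : ℂ) - ((t / (t + r) : ℝ) : ℂ) = ((r / (t + r) : ℝ) : ℂ) := by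
      rw [← Complex.ofReal_one, ← Complex.ofReal_sub]
      congr 1
      field_simp
      ring
    have hd : ∀ (x : ℝ) (w : ℂ), 0 < x → ((x / (t + r) : ℝ) : ℂ) ^ w =
        (x : ℂ) ^ w * (((t + r : ℝ) : ℂ) ^ w)⁻¹ := by
      intro x w hx
      rw [div_eq_mul_inv, Complex.ofReal_mul, Complex.mul_cpow_ofReal_nonneg hx.le (by positivity),
        Complex.ofReal_inv, Complex.inv_cpow _ _ (by
          rw [Complex.arg_ofReal_of_nonneg htr.le]; exact Real.pi_pos.ne)]
    have e1 : ((t + r : ℝ) : ℂ) ^ (u - 1) * ((t + r : ℝ) : ℂ) ^ (v - 1) * ((t + r : ℝ) : ℂ) ^ 2 =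
        ((t + r : ℝ) : ℂ) ^ q := by
      rw [← Complex.cpow_add _ _ htrc, ← Complex.cpow_natCast _ 2, ← Complex.cpow_add _ _ htrc,
        ← Complex.cpow_natCast _ q]
      congr 1
      rw [hv]
      push_cast
      ring
    have e2 : (r : ℂ) * (r : ℂ) ^ (v - 1) = (r : ℂ) ^ v := by
      rw [Complex.cpow_sub _ _ hrc, Complex.cpow_one]
      field_simp
    have hn1 : ((t + r : ℝ) : ℂ) ^ (u - 1) ≠ 0 :=
      fun h => htrc ((Complex.cpow_eq_zero_iff _ _).1 h).1
    have hn2 : ((t + r : ℝ) : ℂ) ^ (v - 1) ≠ 0 :=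
      fun h => htrc ((Complex.cpow_eq_zero_iff _ _).1 h).1
    rw [abs_of_pos (by positivity), hg, Complex.real_smul]
    simp only
    rw [h1, hd t _ ht', hd r _ hr, ← Complex.ofReal_add, ← e1, ← e2, Complex.ofReal_div,
      Complex.ofReal_pow]
    field_simp
  have hgi : IntegrableOn g (Ioo 0 1) := by
    have := Complex.betaIntegral_convergent hu hv0
    rw [intervalIntegrable_iff_integrableOn_Ioo_of_le zero_le_one] at this
    exact this
  have hrv : (r : ℂ) ^ v ≠ 0 := by
    rw [Ne, Complex.cpow_eq_zero_iff]
    simp [hr.ne']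
  have hB : ∫ x in Ioo (0 : ℝ) 1, g x = Complex.betaIntegral u v := by
    rw [Complex.betaIntegral, intervalIntegral.integral_of_le zero_le_one,
      integral_Ioc_eq_integral_Ioo]
  have hint := (integrableOn_image_iff_integrableOn_abs_deriv_smul measurableSet_Ioi hderiv hinj
    g).1 (by rwa [image_div_add_Ioi hr])
  have hI := integral_image_eq_integral_abs_deriv_smul measurableSet_Ioi hderiv hinj g
  rw [image_div_add_Ioi hr, hB, setIntegral_congr_fun measurableSet_Ioi hval,
    integral_const_mul] at hI
  rw [integrableOn_congr_fun hval measurableSet_Ioi] at hint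
  constructor
  · have := hint.const_mul ((r : ℂ) ^ v)⁻¹
    simp only [inv_mul_cancel_left₀ hrv] at this
    exact this
  · rw [Complex.betaIntegral_eq_Gamma_mul_div u v hu hv0] at hI
    have h1 : (r : ℂ) ^ (u - q) = ((r : ℂ) ^ v)⁻¹ := by
      rw [← Complex.cpow_neg, hv, neg_sub]
    have h2 : u + v = q := by rw [hv]; ring
    rw [h2] at hI
    rw [h1, hI, inv_mul_cancel_left₀ hrv]

/-- The real integrals serve as majorants for complex `b`, with `r = ‖b‖`. -/
lemma integral_rpow_div_add_pow {r σ : ℝ} (hr : 0 < r) {q : ℕ} (hσ : 0 < σ) (hσq : σ < q) :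
    IntegrableOn (fun t : ℝ => t ^ (σ - 1) * ((t + r) ^ q)⁻¹) (Ioi 0) ∧
    ∫ t in Ioi (0 : ℝ), t ^ (σ - 1) * ((t + r) ^ q)⁻¹ =
      r ^ (σ - q) * (Real.Gamma σ * Real.Gamma (q - σ) / Real.Gamma q) := by
  obtain ⟨h1, h2⟩ := integral_cpow_div_add_pow_ofReal (u := (σ : ℂ)) hr (by simpa) (by simpa)
  have hval : ∀ t ∈ Ioi (0 : ℝ), (t : ℂ) ^ ((σ : ℂ) - 1) * (((t : ℂ) + r) ^ q)⁻¹ =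
      ((t ^ (σ - 1) * ((t + r) ^ q)⁻¹ : ℝ) : ℂ) := by
    intro t ht
    have ht' : (0 : ℝ) < t := ht
    push_cast
    rw [Complex.ofReal_cpow ht'.le]
    push_cast
    rfl
  constructor
  · rw [integrableOn_congr_fun hval measurableSet_Ioi] at h1
    refine h1.re.congr (ae_of_all _ fun t => ?_)
    simp only [RCLike.re_eq_complex_re, Complex.ofReal_re]
  · rw [setIntegral_congr_fun measurableSet_Ioi hval, integral_complex_ofReal] at h2
    apply Complex.ofReal_injective
    rw [h2]
    push_cast
    rw [Complex.ofReal_cpow hr.le, ← Complex.Gamma_ofReal, ← Complex.Gamma_ofReal,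
      ← Complex.Gamma_ofReal]
    push_cast
    rfl

/-- A point outside a sector around the negative real axis is uniformly far from that axis. -/
lemma sin_mul_le_norm_add {ε : ℝ} (hε : 0 < ε) (hεπ : ε ≤ Real.pi) {b : ℂ}
    (hb : |b.arg| ≤ Real.pi - ε) {t : ℝ} (ht : 0 ≤ t) :
    Real.sin (ε / 2) * (t + ‖b‖) ≤ ‖(t : ℂ) + b‖ := by
  have hs : 0 ≤ Real.sin (ε / 2) := Real.sin_nonneg_of_nonneg_of_le_pi (by linarith) (by linarith)
  refine (pow_le_pow_iff_left₀ (mul_nonneg hs (add_nonneg ht (norm_nonneg b))) (norm_nonneg _)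
    two_ne_zero).1 ?_
  have hcos : -Real.cos ε ≤ Real.cos b.arg := by
    rw [← Real.cos_abs b.arg, ← Real.cos_pi_sub]
    exact Real.cos_le_cos_of_nonneg_of_le_pi (abs_nonneg _) (by linarith) hb
  have hre : b.re = ‖b‖ * Real.cos b.arg := (Complex.norm_mul_cos_arg b).symm
  have hsin : Real.sin (ε / 2) ^ 2 = (1 - Real.cos ε) / 2 := by
    rw [Real.sin_sq_eq_half_sub]
    ring_nf
  have hn : ‖(t : ℂ) + b‖ ^ 2 = t ^ 2 + 2 * t * b.re + ‖b‖ ^ 2 := by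
    rw [← Complex.normSq_eq_norm_sq, ← Complex.normSq_eq_norm_sq, Complex.normSq_apply,
      Complex.normSq_apply]
    simp
    ring
  rw [mul_pow, hn, hsin, hre]
  -- The two sides differ by `2 t ‖b‖ (cos (arg b) + cos ε) + (t - ‖b‖)² (1 + cos ε) / 2`.
  have h1 : 0 ≤ t * ‖b‖ * (Real.cos b.arg + Real.cos ε) := by
    have := norm_nonneg b
    have : 0 ≤ Real.cos b.arg + Real.cos ε := by linarith
    positivity
  have h2 : 0 ≤ (t - ‖b‖) ^ 2 * (1 + Real.cos ε) := by
    have := Real.neg_one_le_cos ε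
    have : 0 ≤ 1 + Real.cos ε := by linarith
    positivity
  nlinarith

lemma norm_cpow_mul_inv_pow_le {b u : ℂ} {c r t : ℝ} (hc : 0 < c) (hr : 0 < r) (ht : 0 < t)
    (hbd : c * (t + r) ≤ ‖(t : ℂ) + b‖) (q : ℕ) :
    ‖(t : ℂ) ^ (u - 1) * (((t : ℂ) + b) ^ q)⁻¹‖ ≤
      (c ^ q)⁻¹ * (t ^ (u.re - 1) * ((t + r) ^ q)⁻¹) := by
  rw [norm_mul, Complex.norm_cpow_eq_rpow_re_of_pos ht, norm_inv, norm_pow, Complex.sub_re,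
    Complex.one_re, mul_left_comm, ← mul_inv, ← mul_pow]
  gcongr

lemma continuousOn_cpow_mul_inv_pow {b : ℂ} (hb : b ∈ Complex.slitPlane) (u : ℂ) (q : ℕ) :
    ContinuousOn (fun t : ℝ => (t : ℂ) ^ (u - 1) * (((t : ℂ) + b) ^ q)⁻¹) (Ioi 0) := by
  refine ContinuousOn.mul ?_ ?_
  · intro t ht
    refine (ContinuousAt.cpow (by fun_prop) (by fun_prop) ?_).continuousWithinAt
    exact Complex.ofReal_mem_slitPlane.2 ht
  · refine ContinuousOn.inv₀ (by fun_prop) fun t ht => pow_ne_zero _ fun h => ?_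
    have ht' : (0 : ℝ) < t := ht
    have hbt : b = ((-t : ℝ) : ℂ) := by push_cast; linear_combination h
    rw [hbt, Complex.ofReal_mem_slitPlane] at hb
    linarith

lemma exists_arg_le_of_mem_slitPlane {b : ℂ} (hb : b ∈ Complex.slitPlane) :
    ∃ ε : ℝ, 0 < ε ∧ ε ≤ Real.pi ∧ |b.arg| ≤ Real.pi - ε := by
  refine ⟨Real.pi - |b.arg|, ?_, by linarith [abs_nonneg b.arg], by linarith⟩
  exact sub_pos.2 (lt_of_le_of_ne (Complex.abs_arg_le_pi b) fun h =>
    (abs_eq Real.pi_pos.le).1 h |>.elim (Complex.slitPlane_arg_ne_pi hb)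
      (Complex.neg_pi_lt_arg b).ne')

/-- The Mellin transform of `(t + b)⁻¹ ^ q` converges. -/
lemma integrableOn_cpow_mul_inv_pow {b : ℂ} (hb : b ∈ Complex.slitPlane) {q : ℕ} {u : ℂ}
    (hu : 0 < u.re) (huq : u.re < q) :
    IntegrableOn (fun t : ℝ => (t : ℂ) ^ (u - 1) * (((t : ℂ) + b) ^ q)⁻¹) (Ioi 0) := by
  obtain ⟨ε, h0, h1, h2⟩ := exists_arg_le_of_mem_slitPlane hb
  have hs : 0 < Real.sin (ε / 2) := Real.sin_pos_of_pos_of_lt_pi (by linarith) (by linarith)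
  have hr : 0 < ‖b‖ := norm_pos_iff.2 (Complex.slitPlane_ne_zero hb)
  refine Integrable.mono' ((integral_rpow_div_add_pow hr hu huq).1.const_mul
    (Real.sin (ε / 2) ^ q)⁻¹) ((continuousOn_cpow_mul_inv_pow hb u q).aestronglyMeasurable
      measurableSet_Ioi) ?_
  filter_upwards [ae_restrict_mem measurableSet_Ioi] with t ht
  exact norm_cpow_mul_inv_pow_le hs hr ht (sin_mul_le_norm_add h0 h1 h2 (le_of_lt ht)) q

/-- Holomorphy in `b` is what lets the formula pass from positive `b` to the slit plane. The
integral is differentiated under the sign, with one majorant for a whole ball around `b`. -/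
lemma differentiableAt_integral_cpow_mul_inv_pow {b : ℂ} (hb : b ∈ Complex.slitPlane) {q : ℕ}
    {u : ℂ} (hu : 0 < u.re) (huq : u.re < q) :
    DifferentiableAt ℂ (fun b : ℂ => ∫ t in Ioi (0 : ℝ),
      (t : ℂ) ^ (u - 1) * (((t : ℂ) + b) ^ q)⁻¹) b := by
  obtain ⟨ε, h0, h1, h2⟩ := exists_arg_le_of_mem_slitPlane hb
  have hs : 0 < Real.sin (ε / 2) := Real.sin_pos_of_pos_of_lt_pi (by linarith) (by linarith)
  have hr : 0 < ‖b‖ := norm_pos_iff.2 (Complex.slitPlane_ne_zero hb)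
  set c := Real.sin (ε / 2) with hc
  -- Moving `b` by less than `c ‖b‖ / 2` costs at most half of the lower bound `c (t + ‖b‖)`.
  have hlow : ∀ x ∈ Metric.ball b (c * ‖b‖ / 2), ∀ t : ℝ, 0 ≤ t →
      c / 2 * (t + ‖b‖) ≤ ‖(t : ℂ) + x‖ := by
    intro x hx t ht
    rw [mem_ball_iff_norm] at hx
    have h3 := sin_mul_le_norm_add h0 h1 h2 ht
    have h4 : ‖(t : ℂ) + b‖ ≤ ‖(t : ℂ) + x‖ + ‖x - b‖ := by
      have := norm_sub_le ((t : ℂ) + x) (x - b)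
      rwa [show (t : ℂ) + x - (x - b) = t + b by ring] at this
    have : 0 ≤ c * t := by positivity
    linarith
  refine (hasDerivAt_integral_of_dominated_loc_of_deriv_le
    (F := fun x t => (t : ℂ) ^ (u - 1) * (((t : ℂ) + x) ^ q)⁻¹) (μ := volume.restrict (Ioi 0))
    (s := Metric.ball b (c * ‖b‖ / 2) ∩ Complex.slitPlane)
    (F' := fun x t => -q * ((t : ℂ) ^ (u - 1) * (((t : ℂ) + x) ^ (q + 1))⁻¹))
    (bound := fun t => q * (((c / 2) ^ (q + 1))⁻¹ *
      (t ^ (u.re - 1) * ((t + ‖b‖) ^ (q + 1))⁻¹)))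
    (inter_mem (Metric.ball_mem_nhds _ (by positivity)) (Complex.isOpen_slitPlane.mem_nhds hb))
    ?_ (integrableOn_cpow_mul_inv_pow hb hu huq) ?_ ?_ ?_ ?_).2.differentiableAt
  · filter_upwards [Complex.isOpen_slitPlane.mem_nhds hb] with x hx
    exact (continuousOn_cpow_mul_inv_pow hx u q).aestronglyMeasurable measurableSet_Ioi
  · exact ((continuousOn_cpow_mul_inv_pow hb u (q + 1)).aestronglyMeasurable
      measurableSet_Ioi).const_mul _
  · filter_upwards [ae_restrict_mem measurableSet_Ioi] with t ht x hx
    rw [norm_mul, norm_neg, Complex.norm_natCast]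
    gcongr
    exact norm_cpow_mul_inv_pow_le (by positivity) hr ht (hlow x hx.1 t (le_of_lt ht)) (q + 1)
  · exact ((integral_rpow_div_add_pow hr hu (by push_cast; linarith)).1.const_mul _).const_mul _
  · filter_upwards [ae_restrict_mem measurableSet_Ioi] with t ht x hx
    have hne : (t : ℂ) + x ≠ 0 := by
      rw [← norm_pos_iff]
      have ht' : (0 : ℝ) < t := ht
      exact lt_of_lt_of_le (by positivity) (hlow x hx.1 t ht'.le)
    have hd := ((((hasDerivAt_id x).const_add (t : ℂ)).pow q).inv (pow_ne_zero q hne)).const_mul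
      ((t : ℂ) ^ (u - 1))
    refine hd.congr_deriv ?_
    rcases Nat.eq_zero_or_pos q with rfl | hq
    · simp
    · obtain ⟨p, rfl⟩ := Nat.exists_eq_succ_of_ne_zero hq.ne'
      simp only [id, Nat.succ_eq_add_one, Nat.add_sub_cancel, Pi.pow_apply]
      field_simp
      ring

/-- The Mellin transform of `(t + b)⁻¹ ^ q`. -/
theorem integral_cpow_mul_inv_pow {b : ℂ} (hb : b ∈ Complex.slitPlane) {q : ℕ} {u : ℂ}
    (hu : 0 < u.re) (huq : u.re < q) :
    ∫ t in Ioi (0 : ℝ), (t : ℂ) ^ (u - 1) * (((t : ℂ) + b) ^ q)⁻¹ =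
      b ^ (u - q) * (Complex.Gamma u * Complex.Gamma (q - u) / Complex.Gamma q) := by
  have hf : AnalyticOnNhd ℂ (fun b : ℂ => ∫ t in Ioi (0 : ℝ),
      (t : ℂ) ^ (u - 1) * (((t : ℂ) + b) ^ q)⁻¹) Complex.slitPlane :=
    DifferentiableOn.analyticOnNhd (fun x hx =>
      (differentiableAt_integral_cpow_mul_inv_pow hx hu huq).differentiableWithinAt)
      Complex.isOpen_slitPlane
  have hg : AnalyticOnNhd ℂ (fun b : ℂ => b ^ (u - q) *
      (Complex.Gamma u * Complex.Gamma (q - u) / Complex.Gamma q)) Complex.slitPlane :=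
    DifferentiableOn.analyticOnNhd (fun x hx =>
      ((differentiableAt_id.cpow_const hx).mul_const _).differentiableWithinAt)
      Complex.isOpen_slitPlane
  refine hf.eqOn_of_preconnected_of_frequently_eq hg
    (Complex.starConvex_one_slitPlane.isPathConnected
      Complex.one_mem_slitPlane).isConnected.isPreconnected Complex.one_mem_slitPlane ?_ hb
  -- Positive points accumulating at `1`, where the real formula holds, suffice for the identity
  -- theorem.
  have hlim : Tendsto (fun n : ℕ => (((1 : ℝ) + 1 / ((n : ℝ) + 1) : ℝ) : ℂ)) atTop (𝓝[≠] 1) := by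
    rw [tendsto_nhdsWithin_iff]
    constructor
    · have h := (tendsto_one_div_add_atTop_nhds_zero_nat (𝕜 := ℝ)).const_add 1
      rw [add_zero] at h
      have := (Complex.continuous_ofReal.tendsto 1).comp h
      rw [Complex.ofReal_one] at this
      exact this
    · refine Eventually.of_forall fun n => ?_
      have : (0 : ℝ) < 1 / ((n : ℝ) + 1) := by positivity
      rw [mem_compl_iff, mem_singleton_iff, Complex.ofReal_eq_one]
      linarith
  refine hlim.frequently (Frequently.of_forall fun n => ?_)
  exact (integral_cpow_div_add_pow_ofReal (by positivity) hu huq).2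

end Beta

end SeqZeta

namespace SeqZeta

/-! ### Convergence exponent, and rotation of the sequence. -/

section Sequence

lemma IsZetaSequence.norm_pos {a : ℕ → ℂ} {α Ψ ε : ℝ} (ha : IsZetaSequence a α Ψ ε) (n : ℕ) :
    0 < ‖a n‖ :=
  ha.pos.trans_le (ha.mono (Nat.zero_le n))

lemma IsZetaSequence.ne_zero {a : ℕ → ℂ} {α Ψ ε : ℝ} (ha : IsZetaSequence a α Ψ ε) (n : ℕ) :
    a n ≠ 0 :=
  norm_pos_iff.1 (ha.norm_pos n)

lemma IsZetaSequence.eps_le_pi {a : ℕ → ℂ} {α Ψ ε : ℝ} (ha : IsZetaSequence a α Ψ ε) :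
    ε ≤ Real.pi := by
  by_contra h
  push Not at h
  exact ha.avoids 0 ⟨ha.ne_zero 0, (Complex.abs_arg_le_pi _).trans_lt h⟩

/-- Places the half-plane `re s > α` inside `re s > 0`, where the Beta integrals converge. -/
lemma IsZetaSequence.exponent_nonneg {a : ℕ → ℂ} {α Ψ ε : ℝ} (ha : IsZetaSequence a α Ψ ε) :
    0 ≤ α := by
  have h : (0 : EReal) ≤ (α : EReal) := by
    rw [← ha.exponent]
    refine le_limsup_of_frequently_le (Eventually.frequently ?_)
    filter_upwards [ha.tendsto.eventually_ge_atTop 1] with n hn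
    have h1 : (0 : ℝ) ≤ Real.log ((n : ℝ) + 1) / Real.log ‖a n‖ :=
      div_nonneg (Real.log_nonneg (by linarith [(Nat.cast_nonneg n : (0 : ℝ) ≤ n)]))
        (Real.log_nonneg hn)
    exact_mod_cast h1
  exact_mod_cast h

/-- For `α < τ < σ` the limsup gives `n + 1 < ‖a n‖ ^ τ` eventually, so `∑ (n + 1) ^ (-σ/τ)` is a
convergent majorant. -/
lemma IsZetaSequence.summable_rpow {a : ℕ → ℂ} {α Ψ ε : ℝ} (ha : IsZetaSequence a α Ψ ε) {σ : ℝ}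
    (hσ : α < σ) : Summable fun n => ‖a n‖ ^ (-σ) := by
  obtain ⟨τ, hατ, hτσ⟩ := exists_between hσ
  have hτ : 0 < τ := ha.exponent_nonneg.trans_lt hατ
  have hlt : ∀ᶠ n : ℕ in atTop,
      ((Real.log ((n : ℝ) + 1) / Real.log ‖a n‖ : ℝ) : EReal) < (τ : EReal) := by
    refine eventually_lt_of_limsup_lt ?_ (by isBoundedDefault)
    rw [ha.exponent]
    exact_mod_cast hατ
  have hs : Summable fun n : ℕ => ((n : ℝ) + 1) ^ (-(σ / τ)) := by
    have h := (summable_nat_add_iff 1).2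
      (Real.summable_nat_rpow.2 (by rw [neg_lt_neg_iff, one_lt_div hτ]; exact hτσ :
        -(σ / τ) < -1))
    simpa using h
  refine Summable.of_norm_bounded_eventually_nat hs ?_
  filter_upwards [hlt, ha.tendsto.eventually_gt_atTop 1] with n hn h1
  have hn' : Real.log ((n : ℝ) + 1) / Real.log ‖a n‖ < τ := by exact_mod_cast hn
  have hpos : 0 < ‖a n‖ := by linarith
  rw [div_lt_iff₀ (Real.log_pos h1), ← Real.log_rpow hpos,
    Real.log_lt_log_iff (by positivity) (by positivity)] at hn'
  rw [Real.norm_of_nonneg (by positivity)]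
  calc ‖a n‖ ^ (-σ) = (‖a n‖ ^ τ) ^ (-(σ / τ)) := by
        rw [← Real.rpow_mul hpos.le]
        congr 1
        field_simp
    _ ≤ ((n : ℝ) + 1) ^ (-(σ / τ)) :=
        Real.rpow_le_rpow_of_nonpos (by positivity) hn'.le (by
          have : 0 < σ / τ := div_pos (by linarith) hτ
          linarith)

/-- The negatives of the points outside a sector, rotated to the direction of the positive axis. -/
noncomputable def rotNeg (Ψ : ℝ) (w : ℂ) : ℂ := -(w * Complex.exp (-(Ψ : ℂ) * Complex.I))

lemma norm_exp_neg_mul_I (Ψ : ℝ) : ‖Complex.exp (-(Ψ : ℂ) * Complex.I)‖ = 1 := by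
  rw [← Complex.ofReal_neg, Complex.norm_exp_ofReal_mul_I]

lemma norm_rotNeg (Ψ : ℝ) (w : ℂ) : ‖rotNeg Ψ w‖ = ‖w‖ := by
  rw [rotNeg, norm_neg, norm_mul, norm_exp_neg_mul_I, mul_one]

/-- Negation changes the sign of `cos (arg z)`, and cosine is decreasing on `[0, π]`; no case
distinction on the sign of the argument is needed. -/
lemma abs_arg_neg_le {z : ℂ} (hz : z ≠ 0) {ε : ℝ} (hε : 0 < ε) (hεπ : ε ≤ Real.pi)
    (h : ε ≤ |z.arg|) : |(-z).arg| ≤ Real.pi - ε := by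
  by_contra hlt
  push Not at hlt
  have h1 : Real.cos |(-z).arg| < Real.cos (Real.pi - ε) :=
    Real.cos_lt_cos_of_nonneg_of_le_pi (by linarith) (Complex.abs_arg_le_pi _) hlt
  have h2 : Real.cos |z.arg| ≤ Real.cos ε :=
    Real.cos_le_cos_of_nonneg_of_le_pi hε.le (Complex.abs_arg_le_pi _) h
  rw [Real.cos_abs, Complex.cos_arg (neg_ne_zero.2 hz), Real.cos_pi_sub] at h1
  rw [Real.cos_abs, Complex.cos_arg hz] at h2
  rw [norm_neg, Complex.neg_re, neg_div] at h1
  linarith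

lemma IsZetaSequence.abs_arg_rotNeg_le {a : ℕ → ℂ} {α Ψ ε : ℝ} (ha : IsZetaSequence a α Ψ ε)
    (n : ℕ) : |(rotNeg Ψ (a n)).arg| ≤ Real.pi - ε := by
  refine abs_arg_neg_le (mul_ne_zero (ha.ne_zero n) (Complex.exp_ne_zero _)) ha.eps_pos
    ha.eps_le_pi ?_
  have h := ha.avoids n
  rw [sector, Set.mem_ofPred_eq, not_and, not_lt] at h
  exact h (ha.ne_zero n)

/-- The phase factor does not depend on `w`, so it can be taken out of the zeta series. -/
lemma zetaTerm_eq (Ψ : ℝ) (s : ℂ) {w : ℂ} (hw : w ≠ 0) :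
    zetaTerm Ψ s w = Complex.exp (-s * ((Ψ - Real.pi : ℝ) : ℂ) * Complex.I) *
      rotNeg Ψ w ^ (-s) := by
  have h : rotNeg Ψ w ≠ 0 := neg_ne_zero.2 (mul_ne_zero hw (Complex.exp_ne_zero _))
  rw [zetaTerm, cutLog, Complex.cpow_def_of_ne_zero h, ← Complex.exp_add, rotNeg]
  congr 1
  ring

end Sequence

/-! ### Termwise Mellin transform of the series over the zeros. -/

section MellinSeries

open MeasureTheory Set

lemma mem_slitPlane_of_arg_le {b : ℂ} (hb : b ≠ 0) {ε : ℝ} (hε : 0 < ε)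
    (h : |b.arg| ≤ Real.pi - ε) : b ∈ Complex.slitPlane := by
  rw [Complex.mem_slitPlane_iff_arg]
  refine ⟨fun h' => ?_, hb⟩
  rw [h', abs_of_pos Real.pi_pos] at h
  linarith

lemma norm_cpow_neg_le {b : ℂ} (hb : b ≠ 0) (s : ℂ) :
    ‖b ^ (-s)‖ ≤ ‖b‖ ^ (-s.re) * Real.exp (Real.pi * |s.im|) := by
  rw [Complex.norm_cpow_of_ne_zero hb, div_eq_mul_inv, ← Real.exp_neg, Complex.neg_re,
    Complex.neg_im]
  gcongr
  have h1 : |b.arg * s.im| ≤ Real.pi * |s.im| := by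
    rw [abs_mul]
    gcongr
    exact Complex.abs_arg_le_pi b
  have := le_abs_self (b.arg * s.im)
  linarith

/-- A bound uniform in `t`: it gives both convergence of the series and its boundedness as `t → 0`.
-/
lemma norm_inv_add_pow_le {ε : ℝ} (hε : 0 < ε) (hεπ : ε ≤ Real.pi) {b : ℂ} (hb : b ≠ 0)
    (harg : |b.arg| ≤ Real.pi - ε) {t : ℝ} (ht : 0 ≤ t) (q : ℕ) :
    ‖(((t : ℂ) + b) ^ q)⁻¹‖ ≤ (Real.sin (ε / 2) ^ q)⁻¹ * ‖b‖ ^ (-(q : ℝ)) := by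
  have hs : 0 < Real.sin (ε / 2) := Real.sin_pos_of_pos_of_lt_pi (by linarith) (by linarith)
  have hb' : 0 < ‖b‖ := norm_pos_iff.2 hb
  have h := sin_mul_le_norm_add hε hεπ harg ht
  rw [norm_inv, norm_pow, Real.rpow_neg hb'.le, Real.rpow_natCast, ← mul_inv, ← mul_pow]
  gcongr
  refine le_trans ?_ h
  gcongr
  linarith

/-- The Mellin transform of a series `∑ (t + b n)⁻¹ ^ q`. -/
theorem mellin_tsum_inv_add_pow {b : ℕ → ℂ} (hb : ∀ n, b n ≠ 0) {ε : ℝ} (hε : 0 < ε)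
    (hεπ : ε ≤ Real.pi) (harg : ∀ n, |(b n).arg| ≤ Real.pi - ε) {q : ℕ} {s : ℂ}
    (hs0 : 0 < s.re) (hsq : s.re < q) (hsum : Summable fun n => ‖b n‖ ^ (-s.re)) {C : ℂ}
    {h : ℝ → ℂ} (hh : ∀ t : ℝ, 0 < t → HasSum (fun n => C * (((t : ℂ) + b n) ^ q)⁻¹) (h t)) :
    mellin h (q - s) = C * (Complex.Gamma s * Complex.Gamma (q - s) / Complex.Gamma q) *
      ∑' n, b n ^ (-s) := by
  have hs : 0 < Real.sin (ε / 2) := Real.sin_pos_of_pos_of_lt_pi (by linarith) (by linarith)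
  have hu : 0 < ((q : ℂ) - s).re := by simpa using hsq
  have huq : ((q : ℂ) - s).re < q := by simpa using hs0
  have hslit : ∀ n, b n ∈ Complex.slitPlane := fun n =>
    mem_slitPlane_of_arg_le (hb n) hε (harg n)
  have hint : ∀ n, IntegrableOn (fun t : ℝ => (t : ℂ) ^ ((q : ℂ) - s - 1) *
      (((t : ℂ) + b n) ^ q)⁻¹) (Ioi 0) := fun n => integrableOn_cpow_mul_inv_pow (hslit n) hu huq
  -- Sum and integral may be exchanged because the integrals of the norms are at most a constant
  -- times `‖b n‖ ^ (-re s)`.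
  have hnorm : Summable fun n => ∫ t in Ioi (0 : ℝ), ‖(t : ℂ) ^ ((q : ℂ) - s - 1) *
      (((t : ℂ) + b n) ^ q)⁻¹‖ := by
    refine Summable.of_nonneg_of_le (fun n => integral_nonneg fun t => norm_nonneg _) (fun n => ?_)
      (hsum.mul_left ((Real.sin (ε / 2) ^ q)⁻¹ * (Real.Gamma ((q : ℂ) - s).re *
        Real.Gamma (q - ((q : ℂ) - s).re) / Real.Gamma q)))
    have hbn : 0 < ‖b n‖ := norm_pos_iff.2 (hb n)
    obtain ⟨h1, h2⟩ := integral_rpow_div_add_pow hbn hu huq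
    calc ∫ t in Ioi (0 : ℝ), ‖(t : ℂ) ^ ((q : ℂ) - s - 1) * (((t : ℂ) + b n) ^ q)⁻¹‖
        ≤ ∫ t in Ioi (0 : ℝ), (Real.sin (ε / 2) ^ q)⁻¹ *
          (t ^ (((q : ℂ) - s).re - 1) * ((t + ‖b n‖) ^ q)⁻¹) := by
          refine setIntegral_mono_on (hint n).norm (h1.const_mul _) measurableSet_Ioi
            fun t ht => ?_
          exact norm_cpow_mul_inv_pow_le hs hbn ht
            (sin_mul_le_norm_add hε hεπ (harg n) (le_of_lt ht)) q
      _ = _ := by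
          rw [integral_const_mul, h2]
          have : ((q : ℂ) - s).re - q = -s.re := by simp
          rw [this]
          ring
  have key := (hasSum_integral_of_summable_integral_norm hint hnorm).tsum_eq
  have hval : ∀ n, ∫ t in Ioi (0 : ℝ), (t : ℂ) ^ ((q : ℂ) - s - 1) * (((t : ℂ) + b n) ^ q)⁻¹ =
      (Complex.Gamma s * Complex.Gamma (q - s) / Complex.Gamma q) * b n ^ (-s) := by
    intro n
    rw [integral_cpow_mul_inv_pow (hslit n) hu huq]
    have : (q : ℂ) - s - q = -s := by ring
    rw [this, sub_sub_cancel]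
    ring
  simp only [hval] at key
  rw [tsum_mul_left] at key
  rw [mul_assoc, key, mellin, ← integral_const_mul]
  refine setIntegral_congr_fun measurableSet_Ioi fun t ht => ?_
  simp only [smul_eq_mul]
  rw [← (hh t ht).tsum_eq, tsum_mul_left, tsum_mul_left]
  ring

end MellinSeries

end SeqZeta

namespace SeqZeta

/-! ### Derivatives of `w ^ β Q(log w)`. -/

section LogPower

open Polynomial

/-- The operator `∏_{i < q} (D + β - i)` on polynomials, `D` being differentiation: it describes the
derivative of order `q` of `w ^ β Q(log w)`. -/
noncomputable def logDerivOp (β : ℂ) (q : ℕ) : Module.End ℂ ℂ[X] :=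
  aeval (derivative : ℂ[X] →ₗ[ℂ] ℂ[X]) (∏ i ∈ Finset.range q, (X + C (β - i)))

/-- Differentiation lowers the degree, so only the constant term of `R` acts on the top coefficient.
-/
lemma aeval_derivative_natDegree_coeff (R : ℂ[X]) {Q : ℂ[X]} {k : ℕ} (hQ : Q.natDegree ≤ k) :
    (aeval (derivative : ℂ[X] →ₗ[ℂ] ℂ[X]) R Q).natDegree ≤ k ∧
      (aeval (derivative : ℂ[X] →ₗ[ℂ] ℂ[X]) R Q).coeff k = R.coeff 0 * Q.coeff k := by
  induction R using Polynomial.induction_on' with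
  | add R S hR hS =>
    rw [map_add, LinearMap.add_apply, coeff_add, coeff_add, hR.2, hS.2, add_mul]
    exact ⟨natDegree_add_le_of_degree_le hR.1 hS.1, rfl⟩
  | monomial n c =>
    have h : aeval (derivative : ℂ[X] →ₗ[ℂ] ℂ[X]) (monomial n c) Q = c • derivative^[n] Q := by
      rw [aeval_monomial, Module.End.mul_apply, Module.algebraMap_end_apply, Module.End.pow_apply]
    rw [h]
    refine ⟨(natDegree_smul_le _ _).trans ((natDegree_iterate_derivative Q n).trans (by omega)), ?_⟩
    rw [coeff_smul, smul_eq_mul, coeff_iterate_derivative, coeff_monomial]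
    rcases Nat.eq_zero_or_pos n with rfl | hn
    · simp
    · rw [if_neg hn.ne', coeff_eq_zero_of_natDegree_lt (by omega)]
      simp

lemma logDerivOp_zero (β : ℂ) (Q : ℂ[X]) : logDerivOp β 0 Q = Q := by
  simp [logDerivOp]

lemma logDerivOp_succ (β : ℂ) (q : ℕ) (Q : ℂ[X]) : logDerivOp β (q + 1) Q =
    derivative (logDerivOp β q Q) + C (β - q) * logDerivOp β q Q := by
  rw [logDerivOp, Finset.prod_range_succ, mul_comm, map_mul, Module.End.mul_apply, map_add, aeval_X,
    aeval_C, LinearMap.add_apply, Module.algebraMap_end_apply, smul_eq_C_mul]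
  rfl

lemma natDegree_logDerivOp_le (β : ℂ) (q : ℕ) {Q : ℂ[X]} {k : ℕ} (hQ : Q.natDegree ≤ k) :
    (logDerivOp β q Q).natDegree ≤ k :=
  (aeval_derivative_natDegree_coeff _ hQ).1

/-- The constant term of the operator is `∏ (β - i)`, nonzero away from `0, …, q - 1`: there the top
power of the logarithm survives. -/
lemma coeff_logDerivOp_ne_zero {β : ℂ} {q : ℕ} (hβ : ∀ i < q, β ≠ i) {Q : ℂ[X]} {k : ℕ}
    (hQ : Q.natDegree ≤ k) (hk : Q.coeff k ≠ 0) : (logDerivOp β q Q).coeff k ≠ 0 := by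
  rw [logDerivOp, (aeval_derivative_natDegree_coeff _ hQ).2, coeff_zero_prod]
  refine mul_ne_zero (Finset.prod_ne_zero_iff.2 fun i hi => ?_) hk
  rw [coeff_add, coeff_X_zero, coeff_C_zero, zero_add, sub_ne_zero]
  exact hβ i (Finset.mem_range.1 hi)

/-- The factor of index `i` is differentiation itself; the others have nonzero constant terms `i -
l`. Hence the degree drops by exactly one. -/
lemma logDerivOp_natCast {i q : ℕ} (hi : i < q) (Q : ℂ[X]) : logDerivOp i q Q =
    aeval (derivative : ℂ[X] →ₗ[ℂ] ℂ[X])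
      (∏ l ∈ (Finset.range q).erase i, (X + C ((i : ℂ) - l))) (derivative Q) := by
  rw [logDerivOp, ← Finset.prod_erase_mul _ _ (Finset.mem_range.2 hi), sub_self, C_0, add_zero,
    map_mul, Module.End.mul_apply, aeval_X]

lemma logDerivOp_natCast_of_natDegree_eq_zero {i q : ℕ} (hi : i < q) {Q : ℂ[X]}
    (hQ : Q.natDegree ≤ 0) : logDerivOp i q Q = 0 := by
  rw [logDerivOp_natCast hi, derivative_of_natDegree_zero (Nat.le_zero.1 hQ), map_zero]

lemma natDegree_derivative_le_of_le_succ {Q : ℂ[X]} {k : ℕ} (hQ : Q.natDegree ≤ k + 1) :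
    (derivative Q).natDegree ≤ k :=
  (natDegree_derivative_le Q).trans (by omega)

lemma natDegree_logDerivOp_natCast_le {i q : ℕ} (hi : i < q) {Q : ℂ[X]} {k : ℕ}
    (hQ : Q.natDegree ≤ k + 1) : (logDerivOp i q Q).natDegree ≤ k := by
  rw [logDerivOp_natCast hi]
  exact (aeval_derivative_natDegree_coeff _ (natDegree_derivative_le_of_le_succ hQ)).1

lemma coeff_logDerivOp_natCast {i q : ℕ} (hi : i < q) {Q : ℂ[X]} {k : ℕ}
    (hQ : Q.natDegree ≤ k + 1) : (logDerivOp i q Q).coeff k =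
      (∏ l ∈ (Finset.range q).erase i, ((i : ℂ) - l)) * (Q.coeff (k + 1) * (k + 1)) := by
  rw [logDerivOp_natCast hi,
    (aeval_derivative_natDegree_coeff _ (natDegree_derivative_le_of_le_succ hQ)).2,
    coeff_derivative, coeff_zero_prod]
  simp

lemma coeff_logDerivOp_natCast_ne_zero {i q : ℕ} (hi : i < q) {Q : ℂ[X]} {k : ℕ}
    (hQ : Q.natDegree ≤ k + 1) (hk : Q.coeff (k + 1) ≠ 0) : (logDerivOp i q Q).coeff k ≠ 0 := by
  rw [coeff_logDerivOp_natCast hi hQ]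
  refine mul_ne_zero (Finset.prod_ne_zero_iff.2 fun l hl => ?_) (mul_ne_zero hk ?_)
  · rw [sub_ne_zero]
    exact fun h => (Finset.mem_erase.1 hl).1 (by exact_mod_cast h.symm)
  · exact_mod_cast Nat.succ_ne_zero k

lemma prod_range_neg_succ (p : ℕ) :
    ∏ l ∈ Finset.range p, ((0 : ℂ) - ((l + 1 : ℕ) : ℂ)) = (-1) ^ p * p.factorial := by
  induction p with
  | zero => simp
  | succ p ih =>
    rw [Finset.prod_range_succ, ih, Nat.factorial_succ]
    push_cast
    ring

/-- The constant `∏_{l=1}^p (-l)` will cancel against `(-1)^p / Γ(p + 1)` in the value at `s = 0`.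
-/
lemma coeff_zero_logDerivOp_zero (p : ℕ) {Q : ℂ[X]} (hQ : Q.natDegree ≤ 1) :
    (logDerivOp 0 (p + 1) Q).coeff 0 = (-1) ^ p * p.factorial * Q.coeff 1 := by
  have h := coeff_logDerivOp_natCast (Nat.succ_pos p) (k := 0) (Q := Q) hQ
  rw [Nat.cast_zero] at h
  rw [h]
  have hr : (Finset.range (p + 1)).erase 0 = (Finset.range p).image (· + 1) := by
    ext x
    simp only [Finset.mem_erase, Finset.mem_range, Finset.mem_image]
    constructor
    · rintro ⟨h0, h1⟩
      exact ⟨x - 1, by omega, by omega⟩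
    · rintro ⟨y, hy, rfl⟩
      omega
  rw [hr, Finset.prod_image (by intro x _ y _ h; simpa using h)]
  rw [prod_range_neg_succ]
  simp

/-- The function `w ^ β Q(log w)`. -/
noncomputable def logPower (β : ℂ) (Q : ℂ[X]) (w : ℂ) : ℂ :=
  Complex.exp (β * Complex.log w) * Q.eval (Complex.log w)

lemma hasDerivAt_logPower (β : ℂ) (Q : ℂ[X]) {w : ℂ} (hw : w ∈ Complex.slitPlane) :
    HasDerivAt (logPower β Q) (logPower (β - 1) (derivative Q + C β * Q) w) w := by
  have hl := Complex.hasDerivAt_log hw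
  have h1 := (hl.const_mul β).cexp
  have h2 := (Q.hasDerivAt (Complex.log w)).comp w hl
  refine (h1.mul h2).congr_deriv ?_
  have hw0 := Complex.slitPlane_ne_zero hw
  rw [logPower, eval_add, eval_mul, eval_C, sub_mul, Complex.exp_sub, one_mul, Complex.exp_log hw0]
  simp only [Function.comp_apply]
  field_simp
  ring

lemma differentiableOn_logPower (β : ℂ) (Q : ℂ[X]) :
    DifferentiableOn ℂ (logPower β Q) Complex.slitPlane := fun _ hw =>
  (hasDerivAt_logPower β Q hw).differentiableAt.differentiableWithinAt

lemma iteratedDeriv_logPower (β : ℂ) (Q : ℂ[X]) (q : ℕ) {w : ℂ} (hw : w ∈ Complex.slitPlane) :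
    iteratedDeriv q (logPower β Q) w = logPower (β - q) (logDerivOp β q Q) w := by
  induction q generalizing w with
  | zero => simp [logDerivOp_zero]
  | succ q ih =>
    have hev : iteratedDeriv q (logPower β Q) =ᶠ[𝓝 w] logPower (β - q) (logDerivOp β q Q) := by
      filter_upwards [Complex.isOpen_slitPlane.mem_nhds hw] with x hx using ih hx
    rw [iteratedDeriv_succ, hev.deriv_eq, (hasDerivAt_logPower _ _ hw).deriv, logDerivOp_succ]
    push_cast
    rw [sub_sub]

end LogPower

/-! ### Mellin transforms of powers with logarithms. -/

section LogIntegral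

open MeasureTheory Set Polynomial

lemma image_exp_Ioi : Real.exp '' Ioi 0 = Ioi 1 := by
  ext x
  simp only [mem_image, mem_Ioi]
  constructor
  · rintro ⟨t, ht, rfl⟩
    exact Real.one_lt_exp_iff.2 ht
  · intro hx
    exact ⟨Real.log x, Real.log_pos hx, Real.exp_log (by linarith)⟩

lemma integrableOn_pow_mul_exp_neg_mul {w : ℂ} (hw : 0 < w.re) (k : ℕ) :
    IntegrableOn (fun x : ℝ => (x : ℂ) ^ k * Complex.exp (-(w * x))) (Ioi 0) := by
  have hr := integrableOn_rpow_mul_exp_neg_mul_rpow (p := 1) (s := k)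
    (lt_of_lt_of_le (by norm_num) (Nat.cast_nonneg k)) one_pos hw
  refine Integrable.mono' hr ((by fun_prop : Continuous fun x : ℝ =>
    (x : ℂ) ^ k * Complex.exp (-(w * x))).aestronglyMeasurable) ?_
  filter_upwards [ae_restrict_mem measurableSet_Ioi] with x hx
  have hx' : (0 : ℝ) < x := hx
  rw [norm_mul, Complex.norm_exp, norm_pow, Complex.norm_real, Real.norm_of_nonneg hx'.le,
    Real.rpow_natCast, Real.rpow_one]
  simp

lemma integral_pow_mul_exp_neg_mul {w : ℂ} (hw : 0 < w.re) (k : ℕ) :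
    ∫ x in Ioi (0 : ℝ), (x : ℂ) ^ k * Complex.exp (-(w * x)) = k.factorial / w ^ (k + 1) := by
  have hw0 : w ≠ 0 := fun h => by simp [h] at hw
  induction k with
  | zero =>
    have h := integral_exp_mul_complex_Ioi (a := -w) (by simpa) 0
    simp only [neg_mul] at h
    simp [h]
  | succ k ih =>
    -- This function vanishes at `0` and at infinity, so its derivative has integral zero: `w
    -- I_{k+1} = (k + 1) I_k`.
    have hd : ∀ x ∈ Ioi (0 : ℝ), HasDerivAt
        (fun x : ℝ => (x : ℂ) ^ (k + 1) * Complex.exp (-(w * x)))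
        (((k : ℂ) + 1) * ((x : ℂ) ^ k * Complex.exp (-(w * x))) -
          w * ((x : ℂ) ^ (k + 1) * Complex.exp (-(w * x)))) x := by
      intro x _
      have h1 := (hasDerivAt_id (x : ℂ)).pow (k + 1)
      have h2 := ((hasDerivAt_id (x : ℂ)).const_mul w).neg.cexp
      refine ((h1.mul h2).comp_ofReal).congr_deriv ?_
      simp
      ring
    have hi := ((integrableOn_pow_mul_exp_neg_mul hw k).const_mul ((k : ℂ) + 1)).sub
      ((integrableOn_pow_mul_exp_neg_mul hw (k + 1)).const_mul w)
    have hlim : Tendsto (fun x : ℝ => (x : ℂ) ^ (k + 1) * Complex.exp (-(w * x))) atTop (𝓝 0) := by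
      rw [tendsto_zero_iff_norm_tendsto_zero]
      refine (tendsto_rpow_mul_exp_neg_mul_atTop_nhds_zero ((k + 1 : ℕ) : ℝ) w.re hw).congr' ?_
      filter_upwards [eventually_ge_atTop 0] with x hx
      rw [norm_mul, norm_pow, Complex.norm_real, Real.norm_of_nonneg hx, Complex.norm_exp,
        Real.rpow_natCast]
      simp
    have hcont : ContinuousWithinAt (fun x : ℝ => (x : ℂ) ^ (k + 1) * Complex.exp (-(w * x)))
        (Ici 0) 0 := by fun_prop
    have h := integral_Ioi_of_hasDerivAt_of_tendsto hcont hd hi hlim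
    rw [integral_sub ((integrableOn_pow_mul_exp_neg_mul hw k).const_mul _)
      ((integrableOn_pow_mul_exp_neg_mul hw (k + 1)).const_mul _), integral_const_mul,
      integral_const_mul, ih] at h
    simp only [Complex.ofReal_zero, ne_eq, Nat.succ_ne_zero, not_false_eq_true, zero_pow, zero_mul,
      sub_zero] at h
    rw [sub_eq_zero] at h
    rw [eq_div_iff (pow_ne_zero _ hw0), pow_succ, mul_comm, mul_assoc, ← h, Nat.factorial_succ]
    push_cast
    field_simp

/-- The substitution `t = e^x` reduces this to the preceding integral. -/
lemma integral_exp_mul_log_pow {w : ℂ} (hw : 0 < w.re) (k : ℕ) :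
    IntegrableOn (fun t : ℝ => Complex.exp ((-w - 1) * Real.log t) * (Real.log t : ℂ) ^ k) (Ioi 1) ∧
    ∫ t in Ioi (1 : ℝ), Complex.exp ((-w - 1) * Real.log t) * (Real.log t : ℂ) ^ k =
      k.factorial / w ^ (k + 1) := by
  set g : ℝ → ℂ := fun t => Complex.exp ((-w - 1) * Real.log t) * (Real.log t : ℂ) ^ k with hg
  have hderiv : ∀ t ∈ Ioi (0 : ℝ), HasDerivWithinAt Real.exp (Real.exp t) (Ioi 0) t :=
    fun t _ => (Real.hasDerivAt_exp t).hasDerivWithinAt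
  have hinj : InjOn Real.exp (Ioi 0) := Real.exp_injective.injOn
  have hval : ∀ x ∈ Ioi (0 : ℝ), |Real.exp x| • g (Real.exp x) =
      (x : ℂ) ^ k * Complex.exp (-(w * x)) := by
    intro x _
    rw [abs_of_pos (Real.exp_pos x), hg, Complex.real_smul]
    simp only
    rw [Real.log_exp, Complex.ofReal_exp, ← mul_assoc, ← Complex.exp_add, mul_comm]
    congr 2
    ring
  have hI := integral_image_eq_integral_abs_deriv_smul measurableSet_Ioi hderiv hinj g
  have hN := integrableOn_image_iff_integrableOn_abs_deriv_smul measurableSet_Ioi hderiv hinj g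
  rw [image_exp_Ioi, setIntegral_congr_fun measurableSet_Ioi hval,
    integral_pow_mul_exp_neg_mul hw] at hI
  rw [image_exp_Ioi, integrableOn_congr_fun hval measurableSet_Ioi] at hN
  exact ⟨hN.2 (integrableOn_pow_mul_exp_neg_mul hw k), hI⟩

/-- The principal part `∑ k, k! P_k / w ^ (k + 1)`. -/
noncomputable def polarPart (P : ℂ[X]) (M : ℕ) (w : ℂ) : ℂ :=
  ∑ k ∈ Finset.range (M + 1), P.coeff k * (k.factorial / w ^ (k + 1))

/-- The Mellin transform of `t ^ β P(log t)` truncated to `t > 1`. -/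
lemma hasMellin_indicator_logPower {P : ℂ[X]} {M : ℕ} (hP : P.natDegree ≤ M) {β u : ℂ}
    (h : (u + β).re < 0) :
    HasMellin (indicator (Ioi 1) fun t : ℝ => logPower β P t) u (polarPart P M (-(u + β))) := by
  have hw : 0 < (-(u + β)).re := by rw [Complex.neg_re]; linarith
  have hval : ∀ t : ℝ, t ∈ Ioi (0 : ℝ) →
      (t : ℂ) ^ (u - 1) • indicator (Ioi 1) (fun t : ℝ => logPower β P t) t =
      indicator (Ioi 1) (fun t : ℝ => ∑ k ∈ Finset.range (M + 1), P.coeff k *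
        (Complex.exp ((-(-(u + β)) - 1) * Real.log t) * (Real.log t : ℂ) ^ k)) t := by
    intro t ht
    have ht' : (0 : ℝ) < t := ht
    by_cases h1 : t ∈ Ioi (1 : ℝ)
    · rw [indicator_of_mem h1, indicator_of_mem h1, logPower, eval_eq_sum_range' (Nat.lt_succ_of_le hP),
        Complex.cpow_def_of_ne_zero (by exact_mod_cast ht'.ne'), smul_eq_mul, ← mul_assoc,
        ← Complex.exp_add, Finset.mul_sum, Complex.ofReal_log ht'.le]
      refine Finset.sum_congr rfl fun k _ => ?_
      rw [mul_left_comm]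
      congr 3
      ring
    · rw [indicator_of_notMem h1, indicator_of_notMem h1, smul_zero]
  have hI := fun k => integral_exp_mul_log_pow hw k
  have hsub : Ioi (1 : ℝ) ∩ Ioi 0 = Ioi 1 := by
    rw [Ioi_inter_Ioi]; norm_num
  constructor
  · rw [MellinConvergent, integrableOn_congr_fun hval measurableSet_Ioi, IntegrableOn,
      integrable_indicator_iff measurableSet_Ioi, IntegrableOn,
      Measure.restrict_restrict measurableSet_Ioi, hsub]
    exact integrable_finsetSum _ fun k _ => (hI k).1.const_mul _
  · rw [mellin, setIntegral_congr_fun measurableSet_Ioi hval, integral_indicator measurableSet_Ioi,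
      Measure.restrict_restrict measurableSet_Ioi, hsub,
      integral_finsetSum _ fun k _ => (hI k).1.const_mul _, polarPart]
    refine Finset.sum_congr rfl fun k _ => ?_
    rw [integral_const_mul, (hI k).2]

end LogIntegral

end SeqZeta

namespace SeqZeta

/-! ### Differentiating asymptotics in a sector. -/

section Sector

lemma mem_sector_zero {ε : ℝ} {z : ℂ} : z ∈ sector 0 ε ↔ z ≠ 0 ∧ |z.arg| < ε := by
  simp [sector]

lemma mul_exp_mem_sector {Ψ ε : ℝ} {w : ℂ} (hw : w ∈ sector 0 ε) :
    w * Complex.exp (Ψ * Complex.I) ∈ sector Ψ ε := by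
  rw [mem_sector_zero] at hw
  refine ⟨mul_ne_zero hw.1 (Complex.exp_ne_zero _), ?_⟩
  rw [mul_assoc, ← Complex.exp_add, neg_mul, add_neg_cancel, Complex.exp_zero, mul_one]
  exact hw.2

lemma sector_zero_subset_slitPlane {ε : ℝ} (hε : ε ≤ Real.pi) :
    sector 0 ε ⊆ Complex.slitPlane := by
  intro z hz
  rw [mem_sector_zero] at hz
  rw [Complex.mem_slitPlane_iff_arg]
  refine ⟨fun h => ?_, hz.1⟩
  rw [h, abs_of_pos Real.pi_pos] at hz
  linarith [hz.2]

lemma isOpen_sector_zero {ε : ℝ} (hε : ε ≤ Real.pi) : IsOpen (sector 0 ε) := by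
  have hc : ContinuousOn (fun z : ℂ => |z.arg|) Complex.slitPlane := fun z hz =>
    (Complex.continuousAt_arg hz).abs.continuousWithinAt
  have h := hc.isOpen_inter_preimage Complex.isOpen_slitPlane (isOpen_Iio (a := ε))
  convert h using 1
  ext z
  constructor
  · intro hz
    exact ⟨sector_zero_subset_slitPlane hε hz, (mem_sector_zero.1 hz).2⟩
  · rintro ⟨h1, h2⟩
    exact mem_sector_zero.2 ⟨Complex.slitPlane_ne_zero h1, h2⟩

lemma ofReal_mem_sector_zero {ε : ℝ} (hε : 0 < ε) {t : ℝ} (ht : 0 < t) :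
    (t : ℂ) ∈ sector 0 ε := by
  rw [mem_sector_zero, Complex.arg_ofReal_of_nonneg ht.le, abs_zero]
  exact ⟨by exact_mod_cast ht.ne', hε⟩

/-- A ball around `1` is scaled by `t`, the sector being a cone. The bound `1 / 2` keeps the scaled
ball at distance at least `t / 2` from `0`. -/
lemma exists_closedBall_subset_sector_zero {ε : ℝ} (hε : 0 < ε) (hεπ : ε ≤ Real.pi) :
    ∃ c : ℝ, 0 < c ∧ c ≤ 1 / 2 ∧ ∀ t : ℝ, 0 < t →
      Metric.closedBall (t : ℂ) (c * t) ⊆ sector 0 ε := by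
  have h1 : (1 : ℂ) ∈ sector 0 ε := by
    have := ofReal_mem_sector_zero hε one_pos
    rwa [Complex.ofReal_one] at this
  obtain ⟨c, hc, hsub⟩ := Metric.nhds_basis_closedBall.mem_iff.1
    ((isOpen_sector_zero hεπ).mem_nhds h1)
  refine ⟨min c (1 / 2), by positivity, min_le_right _ _, fun t ht w hw => ?_⟩
  have htc : (t : ℂ) ≠ 0 := by exact_mod_cast ht.ne'
  have hwt : w / t ∈ sector 0 ε := by
    apply hsub
    rw [mem_closedBall_iff_norm] at hw ⊢
    have : w / t - 1 = (w - t) / t := by field_simp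
    rw [this, norm_div, Complex.norm_real, Real.norm_of_nonneg ht.le, div_le_iff₀ ht]
    exact hw.trans (by gcongr; exact min_le_left _ _)
  rw [mem_sector_zero] at hwt ⊢
  have hw' : w = (t : ℂ) * (w / t) := by field_simp
  refine ⟨fun h => hwt.1 (by simp [h]), ?_⟩
  rw [hw', Complex.arg_real_mul _ ht]
  exact hwt.2

/-- Differentiating an asymptotic estimate in a sector. -/
lemma isBigO_iteratedDeriv_of_isLittleO {ε : ℝ} (hε : 0 < ε) (hεπ : ε ≤ Real.pi) {r : ℂ → ℂ}
    (hr : DifferentiableOn ℂ r (sector 0 ε)) {κ : ℝ} (hκ : κ ≤ 0)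
    (ho : r =o[cobounded ℂ ⊓ 𝓟 (sector 0 ε)] fun z => ‖z‖ ^ κ) (q : ℕ) :
    (fun t : ℝ => iteratedDeriv q r t) =O[atTop] fun t : ℝ => t ^ (κ - q) := by
  obtain ⟨c, hc, hc2, hsub⟩ := exists_closedBall_subset_sector_zero hε hεπ
  have hb := ho.def one_pos
  rw [eventually_inf_principal, ← comap_norm_atTop, eventually_comap] at hb
  obtain ⟨T, hT⟩ := eventually_atTop.1 hb
  refine IsBigO.of_bound (q.factorial * ((1 / 2) ^ κ) / c ^ q) ?_
  filter_upwards [eventually_ge_atTop (2 * T), eventually_gt_atTop 0] with t ht ht0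
  -- The radius is proportional to `t`, so Cauchy's estimate gains `t ^ (-q)`; as `κ ≤ 0`, `‖w‖ ^ κ
  -- ≤ (t / 2) ^ κ` on the circle.
  have hbound := Complex.norm_iteratedDeriv_le_of_forall_mem_sphere_norm_le (f := r) (c := (t : ℂ))
    (R := c * t) (C := (t / 2) ^ κ) q (by positivity) ?_ ?_
  · refine hbound.trans (le_of_eq ?_)
    rw [Real.norm_of_nonneg (by positivity), Real.rpow_sub ht0, Real.rpow_natCast, mul_pow,
      div_eq_mul_one_div t 2, Real.mul_rpow ht0.le (by norm_num)]
    field_simp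
  · refine (hr.mono ?_).diffContOnCl
    rw [closure_ball _ (by positivity)]
    exact hsub t ht0
  · intro w hw
    have hwS := hsub t ht0 (Metric.sphere_subset_closedBall hw)
    rw [mem_sphere_iff_norm] at hw
    have hn : t / 2 ≤ ‖w‖ := by
      have h1 := norm_sub_le w (w - t)
      rw [sub_sub_cancel, Complex.norm_real, Real.norm_of_nonneg ht0.le, hw] at h1
      nlinarith
    have h2 := hT ‖w‖ (by linarith) w rfl hwS
    rw [one_mul, Real.norm_of_nonneg (by positivity)] at h2
    exact h2.trans (Real.rpow_le_rpow_of_nonpos (by positivity) hn hκ)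

end Sector

/-! ### Continuation of the Mellin transform past its abscissa. -/

section Continuation

open MeasureTheory Set Polynomial

lemma continuousOn_logPower_ofReal (β : ℂ) (P : ℂ[X]) :
    ContinuousOn (fun t : ℝ => logPower β P t) (Ioi 0) :=
  (differentiableOn_logPower β P).continuousOn.comp Complex.continuous_ofReal.continuousOn
    fun _ ht => Complex.ofReal_mem_slitPlane.2 ht

lemma locallyIntegrableOn_indicator {f : ℝ → ℂ} {s t : Set ℝ} (hf : LocallyIntegrableOn f s)
    (ht : MeasurableSet t) : LocallyIntegrableOn (indicator t f) s := by
  intro x hx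
  obtain ⟨U, hU, hU'⟩ := hf x hx
  exact ⟨U, hU, hU'.indicator ht⟩

/-- The Mellin transform of a function with an expansion at infinity in powers and logarithms. -/
theorem exists_mellin_continuation {h : ℝ → ℂ} (hc : ContinuousOn h (Ioi 0))
    (h0 : h =O[𝓝[>] 0] fun _ => (1 : ℝ)) {q N M : ℕ} {β : ℕ → ℝ} {P : ℕ → ℂ[X]} {κ α : ℝ}
    (hinf : (fun t : ℝ => h t - ∑ j ∈ Finset.range (N + 1), logPower (β j - q) (P j) t)
      =O[atTop] fun t : ℝ => t ^ (κ - q))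
    (hβ : ∀ j, β j ≤ α) (hP : ∀ j, (P j).natDegree ≤ M) :
    ∃ A : ℂ → ℂ, DifferentiableOn ℂ A {s | κ < s.re ∧ s.re < q} ∧
      ∀ s : ℂ, α < s.re → κ < s.re → s.re < q → mellin h (q - s) =
        A s + ∑ j ∈ Finset.range (N + 1), polarPart (P j) M (s - β j) := by
  set g : ℕ → ℝ → ℂ := fun j => indicator (Ioi 1) fun t : ℝ => logPower (β j - q) (P j) t with hg
  -- With the model terms cut off to `t > 1`, `r` is bounded near `0` and `O(t ^ (κ - q))` at
  -- infinity; its transform at `q - s` is holomorphic for `κ < re s < q`.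
  set r : ℝ → ℂ := fun t => h t - ∑ j ∈ Finset.range (N + 1), g j t with hr
  have hloc : LocallyIntegrableOn r (Ioi 0) := by
    refine (hc.locallyIntegrableOn measurableSet_Ioi).sub ?_
    have : ∀ n, LocallyIntegrableOn (fun t => ∑ j ∈ Finset.range n, g j t) (Ioi 0) := by
      intro n
      induction n with
      | zero => simpa using locallyIntegrableOn_zero
      | succ n ih =>
        simp only [Finset.sum_range_succ]
        exact ih.add (locallyIntegrableOn_indicator
          ((continuousOn_logPower_ofReal _ _).locallyIntegrableOn measurableSet_Ioi)
          measurableSet_Ioi)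
    exact this _
  have htop : r =O[atTop] fun t : ℝ => t ^ (-((q : ℝ) - κ)) := by
    rw [neg_sub]
    refine hinf.congr' ?_ EventuallyEq.rfl
    filter_upwards [eventually_gt_atTop 1] with t ht
    simp only [hr, hg]
    congr 1
    refine Finset.sum_congr rfl fun j _ => ?_
    rw [indicator_of_mem (mem_Ioi.2 ht)]
  have hbot : r =O[𝓝[>] 0] fun t : ℝ => t ^ (-(0 : ℝ)) := by
    simp only [neg_zero, Real.rpow_zero]
    refine h0.congr' ?_ EventuallyEq.rfl
    have : ∀ᶠ t : ℝ in 𝓝[>] 0, t < 1 :=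
      eventually_nhdsWithin_of_eventually_nhds (eventually_lt_nhds one_pos)
    filter_upwards [this] with t ht
    simp only [hr, hg]
    rw [Finset.sum_eq_zero, sub_zero]
    intro j _
    rw [indicator_of_notMem (by simpa using ht.le)]
  refine ⟨fun s => mellin r (q - s), ?_, ?_⟩
  · rintro s ⟨hs1, hs2⟩
    have hd := mellin_differentiableAt_of_isBigO_rpow (s := (q : ℂ) - s) hloc htop
      (by simpa using hs1) hbot (by simpa using hs2)
    have hsub : DifferentiableAt ℂ (fun s : ℂ => (q : ℂ) - s) s := by fun_prop
    exact (hd.comp s hsub).differentiableWithinAt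
  · intro s hs hs1 hs2
    have hconv : MellinConvergent r ((q : ℂ) - s) :=
      mellinConvergent_of_isBigO_rpow hloc htop (by simpa using hs1) hbot (by simpa using hs2)
    have hgm : ∀ j, HasMellin (g j) ((q : ℂ) - s) (polarPart (P j) M (s - β j)) := by
      intro j
      have h1 := hasMellin_indicator_logPower (hP j) (β := β j - q) (u := q - s) (by
        have := hβ j
        simp
        linarith)
      have h2 : -((q : ℂ) - s + (β j - q)) = s - β j := by ring
      rwa [h2] at h1
    have hsum : ∀ n, HasMellin (fun t => ∑ j ∈ Finset.range n, g j t) ((q : ℂ) - s)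
        (∑ j ∈ Finset.range n, polarPart (P j) M (s - β j)) := by
      intro n
      induction n with
      | zero => simp [HasMellin, MellinConvergent, mellin]
      | succ n ih =>
        simp only [Finset.sum_range_succ]
        have := hasMellin_add ih.1 (hgm n).1
        rwa [ih.2, (hgm n).2] at this
    have hadd := (hasMellin_add hconv (hsum (N + 1)).1).2
    rw [(hsum (N + 1)).2] at hadd
    rw [← hadd]
    simp [hr]

/-- Continuation of the zeta function of the sequence `b`, in terms of the expansion of the
logarithm of an entire function with zeros `-b n`. -/
theorem exists_continuation {F : ℂ → ℂ} (hF : Differentiable ℂ F) {b : ℕ → ℂ}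
    (hb : ∀ n, b n ≠ 0) (hmono : Monotone fun n => ‖b n‖)
    (hlim : Tendsto (fun n => ‖b n‖) atTop atTop)
    (hz : ∀ w, analyticOrderAt F w = Set.encard {n | -b n = w}) {ε : ℝ} (hε : 0 < ε)
    (hεπ : ε ≤ Real.pi) (harg : ∀ n, |(b n).arg| ≤ Real.pi - ε) {α : ℝ} (hα : 0 ≤ α)
    (hsum : ∀ σ, α < σ → Summable fun n => ‖b n‖ ^ (-σ)) {p : ℕ} (hp : α < p + 1)
    {ρ : ℝ} (hρ : ρ < p + 1) (hgrowth : F =O[cobounded ℂ] fun z => Real.exp (‖z‖ ^ ρ))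
    {f : ℂ → ℂ} (hf : DifferentiableOn ℂ f (sector 0 ε))
    (hexp : ∀ z ∈ sector 0 ε, Complex.exp (f z) = F z) {N M : ℕ} {β : ℕ → ℝ} {Q : ℕ → ℂ[X]}
    (hβ : ∀ j, β j ≤ α) (hQ : ∀ j, (Q j).natDegree ≤ M) {κ : ℝ} (hκ : κ < 0)
    (ho : (fun z => f z - ∑ j ∈ Finset.range (N + 1), logPower (β j) (Q j) z)
      =o[cobounded ℂ ⊓ 𝓟 (sector 0 ε)] fun z => ‖z‖ ^ κ) :
    ∃ A : ℂ → ℂ, DifferentiableOn ℂ A {s | κ < s.re ∧ s.re < p + 1} ∧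
      ∀ s : ℂ, α < s.re → s.re < p + 1 →
        Complex.Gamma s * Complex.Gamma (p + 1 - s) * ∑' n, b n ^ (-s) =
          (-1) ^ p * (A s + ∑ j ∈ Finset.range (N + 1),
            polarPart (logDerivOp (β j) (p + 1) (Q j)) M (s - β j)) := by
  have hS := isOpen_sector_zero hεπ
  have hSs := sector_zero_subset_slitPlane hεπ
  set h : ℝ → ℂ := fun t => iteratedDeriv (p + 1) f t with hh
  have hq1 : Summable fun n => ‖b n‖ ^ (-((p + 1 : ℕ) : ℝ)) := hsum _ (by push_cast; exact hp)
  have hbd : ∀ t : ℝ, 0 < t → ∀ n, ‖(-1) ^ p * p.factorial * (((t : ℂ) + b n) ^ (p + 1))⁻¹‖ ≤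
      p.factorial * (Real.sin (ε / 2) ^ (p + 1))⁻¹ * ‖b n‖ ^ (-((p + 1 : ℕ) : ℝ)) := by
    intro t ht n
    rw [norm_mul, norm_mul, norm_pow, norm_neg, norm_one, one_pow, one_mul, Complex.norm_natCast,
      mul_assoc]
    gcongr
    exact norm_inv_add_pow_le hε hεπ (hb n) (harg n) ht.le (p + 1)
  have hsumT := hq1.mul_left (p.factorial * (Real.sin (ε / 2) ^ (p + 1))⁻¹)
  have hseries : ∀ t : ℝ, 0 < t →
      HasSum (fun n => (-1) ^ p * p.factorial * (((t : ℂ) + b n) ^ (p + 1))⁻¹) (h t) := by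
    intro t ht
    have hs := Summable.of_norm_bounded hsumT (hbd t ht)
    have h1 := tendsto_sum_iteratedDeriv_log hF hb hmono hlim hz hS hf hexp
      (ofReal_mem_sector_zero hε ht) p hρ hgrowth
    rw [hs.hasSum_iff_tendsto_nat]
    exact h1
  have hcont : ContinuousOn h (Ioi 0) := by
    have h1 : ContinuousOn (iteratedDeriv (p + 1) f) (sector 0 ε) := by
      have h2 : ∀ n, DifferentiableOn ℂ (iteratedDeriv n f) (sector 0 ε) := by
        intro n
        induction n with
        | zero => simpa using hf
        | succ n ih =>
          rw [iteratedDeriv_succ]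
          exact ih.deriv hS
      exact (h2 _).continuousOn
    exact h1.comp Complex.continuous_ofReal.continuousOn fun t ht => ofReal_mem_sector_zero hε ht
  have h0 : h =O[𝓝[>] 0] fun _ => (1 : ℝ) := by
    refine IsBigO.of_bound (∑' n, p.factorial * (Real.sin (ε / 2) ^ (p + 1))⁻¹ *
      ‖b n‖ ^ (-((p + 1 : ℕ) : ℝ))) ?_
    filter_upwards [self_mem_nhdsWithin] with t ht
    rw [norm_one, mul_one, ← (hseries t ht).tsum_eq]
    exact tsum_of_norm_bounded hsumT.hasSum (hbd t ht)
  have hmod : DifferentiableOn ℂ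
      (fun z => ∑ j ∈ Finset.range (N + 1), logPower (β j) (Q j) z) (sector 0 ε) :=
    DifferentiableOn.fun_sum fun j _ => (differentiableOn_logPower _ _).mono hSs
  have hinf : (fun t : ℝ => h t - ∑ j ∈ Finset.range (N + 1),
      logPower (β j - (p + 1 : ℕ)) (logDerivOp (β j) (p + 1) (Q j)) t)
      =O[atTop] fun t : ℝ => t ^ (κ - (p + 1 : ℕ)) := by
    refine (isBigO_iteratedDeriv_of_isLittleO hε hεπ (hf.sub hmod) hκ.le ho (p + 1)).congr' ?_
      EventuallyEq.rfl
    filter_upwards [eventually_gt_atTop 0] with t ht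
    have htS := ofReal_mem_sector_zero hε ht
    have hca : ∀ g : ℂ → ℂ, DifferentiableOn ℂ g (sector 0 ε) → ContDiffAt ℂ (p + 1 : ℕ) g t :=
      fun g hg => (hg.analyticAt (hS.mem_nhds htS)).contDiffAt
    rw [iteratedDeriv_sub (hca _ hf) (hca _ hmod), iteratedDeriv_fun_sum fun j _ =>
      hca _ ((differentiableOn_logPower _ _).mono hSs)]
    simp only [hh]
    congr 1
    exact Finset.sum_congr rfl fun j _ => iteratedDeriv_logPower _ _ _ (hSs htS)
  obtain ⟨A, hA, hAeq⟩ := exists_mellin_continuation hcont h0 hinf hβ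
    fun j => natDegree_logDerivOp_le _ _ (hQ j)
  have hcast : ((p + 1 : ℕ) : ℂ) = p + 1 := by push_cast; rfl
  refine ⟨A, by simpa using hA, fun s hs1 hs2 => ?_⟩
  have h1 := hAeq s hs1 (by linarith) (by push_cast; exact hs2)
  rw [mellin_tsum_inv_add_pow hb hε hεπ harg (by linarith) (by push_cast; exact hs2)
    (hsum _ hs1) hseries, hcast, Complex.Gamma_nat_eq_factorial] at h1
  rw [← h1]
  have hpf : (p.factorial : ℂ) ≠ 0 := by exact_mod_cast p.factorial_ne_zero
  have hsq : ((-1 : ℂ) ^ p) * (-1) ^ p = 1 := by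
    rw [← mul_pow]; simp
  field_simp
  linear_combination (-(Complex.Gamma s * Complex.Gamma (p + 1 - s) * ∑' n, b n ^ (-s))) * hsq

end Continuation

end SeqZeta

namespace SeqZeta

/-! ### Rotation to the direction `Ψ`, and the continuation formula. -/

section Rotation

open Polynomial

lemma rotNeg_ne_zero (Ψ : ℝ) {w : ℂ} (hw : w ≠ 0) : rotNeg Ψ w ≠ 0 :=
  neg_ne_zero.2 (mul_ne_zero hw (Complex.exp_ne_zero _))

lemma neg_rotNeg_eq_iff (Ψ : ℝ) (z w : ℂ) :
    -rotNeg Ψ z = w ↔ z = w * Complex.exp (Ψ * Complex.I) := by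
  rw [rotNeg, neg_neg, neg_mul, Complex.exp_neg, ← div_eq_mul_inv,
    div_eq_iff (Complex.exp_ne_zero _)]

lemma norm_mul_exp_mul_I (Ψ : ℝ) (w : ℂ) : ‖w * Complex.exp (Ψ * Complex.I)‖ = ‖w‖ := by
  rw [norm_mul, Complex.norm_exp_ofReal_mul_I, mul_one]

lemma tendsto_mul_exp_cobounded (Ψ : ℝ) :
    Tendsto (fun w : ℂ => w * Complex.exp (Ψ * Complex.I)) (cobounded ℂ) (cobounded ℂ) := by
  rw [← tendsto_norm_atTop_iff_cobounded]
  simp only [norm_mul_exp_mul_I]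
  exact tendsto_norm_cobounded_atTop

lemma rayLog_mul_exp (Ψ : ℝ) (w : ℂ) :
    rayLog Ψ (w * Complex.exp (Ψ * Complex.I)) = Complex.log w + Ψ * Complex.I := by
  rw [rayLog, mul_assoc, ← Complex.exp_add, neg_mul, add_neg_cancel, Complex.exp_zero, mul_one]

/-- The polynomial with coefficients `d 0, …, d M`. -/
noncomputable def coeffPoly (M : ℕ) (d : ℕ → ℂ) : ℂ[X] :=
  ∑ k ∈ Finset.range (M + 1), monomial k (d k)

lemma coeff_coeffPoly (M : ℕ) (d : ℕ → ℂ) (k : ℕ) :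
    (coeffPoly M d).coeff k = if k ≤ M then d k else 0 := by
  rw [coeffPoly, finsetSum_coeff]
  simp only [coeff_monomial, Finset.sum_ite_eq', Finset.mem_range, Nat.lt_succ_iff]

/-- The polynomial `Q` with `w ^ β Q(log w) = z ^ β ∑ d_k (log z) ^ k` for `z = w e ^ {iΨ}`. -/
noncomputable def rotPoly (Ψ : ℝ) (β : ℂ) (M : ℕ) (d : ℕ → ℂ) : ℂ[X] :=
  C (Complex.exp (β * (Ψ * Complex.I))) * taylor (Ψ * Complex.I) (coeffPoly M d)

lemma logPower_rotPoly (Ψ : ℝ) (β : ℂ) (M : ℕ) (d : ℕ → ℂ) (w : ℂ) :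
    logPower β (rotPoly Ψ β M d) w = ∑ k ∈ Finset.range (M + 1),
      d k * Complex.exp (β * rayLog Ψ (w * Complex.exp (Ψ * Complex.I))) *
        rayLog Ψ (w * Complex.exp (Ψ * Complex.I)) ^ k := by
  rw [logPower, rotPoly, rayLog_mul_exp, eval_mul, eval_C, taylor_eval, coeffPoly, eval_finsetSum,
    ← mul_assoc, ← Complex.exp_add, ← mul_add, Finset.mul_sum]
  refine Finset.sum_congr rfl fun k _ => ?_
  rw [eval_monomial]
  ring

lemma natDegree_rotPoly_le (Ψ : ℝ) (β : ℂ) {M n : ℕ} {d : ℕ → ℂ}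
    (hd : ∀ k ≤ M, n < k → d k = 0) : (rotPoly Ψ β M d).natDegree ≤ n := by
  refine (natDegree_C_mul_le _ _).trans ?_
  rw [natDegree_taylor, natDegree_le_iff_coeff_eq_zero]
  intro k hk
  rw [coeff_coeffPoly]
  split_ifs with h
  · exact hd k h hk
  · rfl

/-- Shifting the variable keeps the top coefficient, so the rotation only multiplies it by a nonzero
constant. The case `n > M` is admitted for use with `n = 1`, `M = 0`. -/
lemma coeff_rotPoly (Ψ : ℝ) (β : ℂ) {M n : ℕ} {d : ℕ → ℂ} (hn : ∀ k ≤ M, n < k → d k = 0) :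
    (rotPoly Ψ β M d).coeff n =
      Complex.exp (β * (Ψ * Complex.I)) * if n ≤ M then d n else 0 := by
  have hdeg : (coeffPoly M d).natDegree ≤ n := by
    rw [natDegree_le_iff_coeff_eq_zero]
    intro k hk
    rw [coeff_coeffPoly]
    split_ifs with h
    · exact hn k h hk
    · rfl
  rw [rotPoly, coeff_C_mul, ← coeff_coeffPoly]
  congr 1
  rcases hdeg.eq_or_lt with h | h
  · rw [← h, coeff_taylor_natDegree, leadingCoeff]
  · rw [coeff_eq_zero_of_natDegree_lt h, coeff_eq_zero_of_natDegree_lt (by rwa [natDegree_taylor])]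

lemma rotPoly_eq_zero (Ψ : ℝ) (β : ℂ) {M : ℕ} {d : ℕ → ℂ} (hd : ∀ k ≤ M, d k = 0) :
    rotPoly Ψ β M d = 0 := by
  have h : coeffPoly M d = 0 := by
    rw [coeffPoly]
    refine Finset.sum_eq_zero fun k hk => ?_
    rw [hd k (Nat.lt_succ_iff.1 (Finset.mem_range.1 hk)), map_zero]
  rw [rotPoly, h, map_zero, mul_zero]

/-- The polynomial governing the singularity of the zeta function at `α - j / m`. -/
noncomputable def singularPoly (α Ψ : ℝ) (m M p : ℕ) (d : ℕ → ℕ → ℂ) (j : ℕ) : ℂ[X] :=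
  logDerivOp (expo α m j) (p + 1) (rotPoly Ψ (expo α m j) M (d j))

/-- The zeta function up to elementary factors. -/
noncomputable def mellinSide (α Ψ : ℝ) (m M N p : ℕ) (d : ℕ → ℕ → ℂ) (A : ℂ → ℂ) (s : ℂ) : ℂ :=
  A s + ∑ j ∈ Finset.range (N + 1), polarPart (singularPoly α Ψ m M p d j) M (s - expo α m j)

/-- The nowhere vanishing factor relating the zeta function to `mellinSide`. -/
noncomputable def unitFactor (Ψ : ℝ) (p : ℕ) (s : ℂ) : ℂ :=
  Complex.exp (-s * ((Ψ - Real.pi : ℝ) : ℂ) * Complex.I) * (-1) ^ p *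
    (Complex.Gamma (p + 1 - s))⁻¹

/-- The continuation of the zeta function to the half-plane `re s < p + 1`. -/
noncomputable def zetaContinuation (α Ψ : ℝ) (m M N p : ℕ) (d : ℕ → ℕ → ℂ) (A : ℂ → ℂ) (s : ℂ) :
    ℂ :=
  unitFactor Ψ p s * ((Complex.Gamma s)⁻¹ * mellinSide α Ψ m M N p d A s)

/-- The infimum defining the order need not be attained, but some admissible exponent lies below any
`q > α`. -/
lemma exists_growth_lt {F : ℂ → ℂ} {α q : ℝ} (hα : 0 ≤ α) (h : growthOrder F ≤ ENNReal.ofReal α)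
    (hq : α < q) : ∃ ρ : ℝ, ρ < q ∧ F =O[cobounded ℂ] fun z => Real.exp (‖z‖ ^ ρ) := by
  have hlt : growthOrder F < ENNReal.ofReal q :=
    h.trans_lt ((ENNReal.ofReal_lt_ofReal_iff (hα.trans_lt hq)).2 hq)
  rw [growthOrder, iInf_lt_iff] at hlt
  obtain ⟨ρ, hρ⟩ := hlt
  rw [iInf_lt_iff] at hρ
  obtain ⟨hO, hρq⟩ := hρ
  refine ⟨ρ, ?_, hO⟩
  rw [← ENNReal.ofReal_coe_nnreal, ENNReal.ofReal_lt_ofReal_iff (hα.trans_lt hq)] at hρq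
  exact hρq

lemma expo_le (α : ℝ) (m j : ℕ) : expo α m j ≤ α := by
  rw [expo]
  have : (0 : ℝ) ≤ (j : ℝ) / m := by positivity
  linarith

theorem exists_zeta_continuation {a : ℕ → ℂ} {α Ψ ε : ℝ} (ha : IsZetaSequence a α Ψ ε)
    {F : ℂ → ℂ} (hF : IsCharacteristicFunction F a α) {m M N : ℕ} {δ : ℝ}
    (hκ : expo α m N - δ < 0) {d : ℕ → ℕ → ℂ} (hd : HasLogExpansion F α Ψ ε m M N δ d) {p : ℕ}
    (hp : α < p + 1) :
    ∃ A : ℂ → ℂ, DifferentiableOn ℂ A {s | expo α m N - δ < s.re ∧ s.re < p + 1} ∧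
      ∀ s : ℂ, α < s.re → s.re < p + 1 →
        zetaSeries a Ψ s = zetaContinuation α Ψ m M N p d A s := by
  obtain ⟨L, hL, hLexp, hLo⟩ := hd
  set e : ℂ := Complex.exp (Ψ * Complex.I) with he
  have he0 : e ≠ 0 := Complex.exp_ne_zero _
  obtain ⟨ρ, hρ, hgrowth⟩ := exists_growth_lt ha.exponent_nonneg hF.order_le hp
  have hz : ∀ w, analyticOrderAt (fun w => F (w * e)) w =
      Set.encard {n | -(rotNeg Ψ (a n)) = w} := by
    intro w
    have hg : HasDerivAt (fun w : ℂ => w * e) e w := by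
      simpa using (hasDerivAt_id w).mul_const e
    have h := analyticOrderAt_comp_of_deriv_ne_zero (f := F) (g := fun w : ℂ => w * e) (z₀ := w)
      (by fun_prop) (by rw [hg.deriv]; exact he0)
    have h2 := hF.zeros (w * e)
    rw [← h] at h2
    simp only [neg_rotNeg_eq_iff]
    exact h2
  have hmap : Set.MapsTo (fun w : ℂ => w * e) (sector 0 ε) (sector Ψ ε) :=
    fun w hw => mul_exp_mem_sector hw
  have hsum : ∀ σ, α < σ → Summable fun n => ‖rotNeg Ψ (a n)‖ ^ (-σ) := by
    intro σ hσ
    simp only [norm_rotNeg]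
    exact ha.summable_rpow hσ
  obtain ⟨A, hA, hAeq⟩ := exists_continuation (F := fun w => F (w * e))
    (hF.entire.comp (by fun_prop)) (b := fun n => rotNeg Ψ (a n))
    (fun n => rotNeg_ne_zero Ψ (ha.ne_zero n))
    (by simp only [norm_rotNeg]; exact ha.mono) (by simp only [norm_rotNeg]; exact ha.tendsto) hz
    ha.eps_pos ha.eps_le_pi ha.abs_arg_rotNeg_le ha.exponent_nonneg hsum hp hρ
    (by simpa only [Function.comp_def, norm_mul_exp_mul_I, he] using
      hgrowth.comp_tendsto (tendsto_mul_exp_cobounded Ψ))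
    (f := fun w => L (w * e)) (hL.comp (by fun_prop) hmap) (fun w hw => hLexp _ (hmap hw))
    (N := N) (M := M) (β := expo α m) (Q := fun j => rotPoly Ψ (expo α m j) M (d j))
    (expo_le α m) (fun j => natDegree_rotPoly_le _ _ (by intro k h1 h2; omega)) hκ
    (by
      simp only [logPower_rotPoly]
      have ht : Tendsto (fun w : ℂ => w * e) (cobounded ℂ ⊓ 𝓟 (sector 0 ε))
          (cobounded ℂ ⊓ 𝓟 (sector Ψ ε)) :=
        tendsto_inf.2 ⟨(tendsto_mul_exp_cobounded Ψ).mono_left inf_le_left,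
          (tendsto_principal_principal.2 hmap).mono_left inf_le_right⟩
      simpa only [Function.comp_def, norm_mul_exp_mul_I, he] using hLo.comp_tendsto ht)
  refine ⟨A, hA, fun s hs1 hs2 => ?_⟩
  have h := hAeq s hs1 hs2
  have hs0 : 0 < s.re := ha.exponent_nonneg.trans_lt hs1
  have hG1 := Complex.Gamma_ne_zero_of_re_pos hs0
  have hG2 : Complex.Gamma (p + 1 - s) ≠ 0 :=
    Complex.Gamma_ne_zero_of_re_pos (by simp; linarith)
  have hsq : ((-1 : ℂ) ^ p) * (-1) ^ p = 1 := by
    rw [← mul_pow]; simp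
  have hz : zetaSeries a Ψ s = Complex.exp (-s * ((Ψ - Real.pi : ℝ) : ℂ) * Complex.I) *
      ∑' n, rotNeg Ψ (a n) ^ (-s) := by
    rw [zetaSeries, ← tsum_mul_left]
    exact tsum_congr fun n => zetaTerm_eq Ψ s (ha.ne_zero n)
  rw [hz, zetaContinuation, unitFactor, mellinSide]
  simp only [singularPoly]
  set T := A s + ∑ j ∈ Finset.range (N + 1), polarPart
    (logDerivOp (expo α m j) (p + 1) (rotPoly Ψ (expo α m j) M (d j))) M (s - expo α m j)
  have h3 : ∑' n, rotNeg Ψ (a n) ^ (-s) =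
      (-1) ^ p * T / (Complex.Gamma s * Complex.Gamma (p + 1 - s)) := by
    rw [eq_div_iff (mul_ne_zero hG1 hG2), ← h]
    ring
  rw [h3]
  field_simp

lemma summable_zetaTerm {a : ℕ → ℂ} {α Ψ ε : ℝ} (ha : IsZetaSequence a α Ψ ε) {s : ℂ}
    (hs : α < s.re) : Summable fun n => zetaTerm Ψ s (a n) := by
  simp only [fun n => zetaTerm_eq Ψ s (ha.ne_zero n)]
  refine Summable.mul_left _ (Summable.of_norm_bounded
    ((ha.summable_rpow hs).mul_right (Real.exp (Real.pi * |s.im|))) fun n => ?_)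
  have h := norm_cpow_neg_le (rotNeg_ne_zero Ψ (ha.ne_zero n)) s
  rwa [norm_rotNeg] at h

end Rotation

end SeqZeta

namespace SeqZeta

/-! ### Pole orders of the continuation. -/

section Orders

open Polynomial

/-- The case `s = β`, `P = 0` is included: it makes exponents whose polynomial is annihilated
regular points. -/
lemma analyticAt_polarPart {P : ℂ[X]} {β s : ℂ} (M : ℕ) (h : P ≠ 0 → s ≠ β) :
    AnalyticAt ℂ (fun s => polarPart P M (s - β)) s := by
  by_cases hP : P = 0
  · simp only [polarPart, hP, coeff_zero, zero_mul, Finset.sum_const_zero]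
    exact analyticAt_const
  · unfold polarPart
    refine Finset.analyticAt_fun_sum _ fun k _ => ?_
    exact analyticAt_const.mul (analyticAt_const.div (by fun_prop)
      (pow_ne_zero _ (sub_ne_zero.2 (h hP))))

lemma meromorphicAt_polarPart (P : ℂ[X]) (β s : ℂ) (M : ℕ) :
    MeromorphicAt (fun s => polarPart P M (s - β)) s := by
  unfold polarPart
  refine MeromorphicAt.fun_sum fun k _ => ?_
  exact (MeromorphicAt.const _ _).mul ((MeromorphicAt.const _ _).div
    (AnalyticAt.meromorphicAt (by fun_prop)))

/-- After multiplication by `(s - β) ^ (n + 1)` the value at `β` is `n!` times the top coefficient.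
-/
lemma meromorphicOrderAt_polarPart {P : ℂ[X]} {M n : ℕ} (hM : P.natDegree ≤ M)
    (hn : P.natDegree ≤ n) (hc : P.coeff n ≠ 0) (β : ℂ) :
    meromorphicOrderAt (fun s => polarPart P M (s - β)) β = ((-(n + 1 : ℕ) : ℤ) : WithTop ℤ) := by
  have hnM : n ≤ M := (le_natDegree_of_ne_zero hc).trans hM
  rw [meromorphicOrderAt_eq_int_iff (meromorphicAt_polarPart P β β M)]
  refine ⟨fun s => ∑ k ∈ Finset.range (n + 1), P.coeff k * k.factorial * (s - β) ^ (n - k),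
    by fun_prop, ?_, ?_⟩
  · simp only
    rw [Finset.sum_range_succ, Finset.sum_eq_zero]
    · simp only [sub_self, Nat.sub_self, pow_zero, mul_one, zero_add]
      exact mul_ne_zero hc (by exact_mod_cast n.factorial_ne_zero)
    · intro k hk
      rw [sub_self, zero_pow (by have := Finset.mem_range.1 hk; omega), mul_zero]
  · filter_upwards [self_mem_nhdsWithin] with s hs
    have hs' : s - β ≠ 0 := sub_ne_zero.2 hs
    have hsub : Finset.range (n + 1) ⊆ Finset.range (M + 1) :=
      Finset.range_subset_range.2 (by omega)
    rw [polarPart, ← Finset.sum_subset hsub, zpow_neg, zpow_natCast, smul_eq_mul, Finset.mul_sum]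
    · refine Finset.sum_congr rfl fun k hk => ?_
      have hk' : n + 1 = (n - k) + (k + 1) := by have := Finset.mem_range.1 hk; omega
      rw [hk', pow_add]
      field_simp
      ring
    · intro k _ hk
      rw [coeff_eq_zero_of_natDegree_lt (by rw [Finset.mem_range] at hk; omega), zero_mul]

lemma meromorphicOrderAt_inv_Gamma_of_ne {s : ℂ} (hs : ∀ n : ℕ, s ≠ -n) :
    meromorphicOrderAt (fun s => (Complex.Gamma s)⁻¹) s = 0 := by
  have ha : AnalyticAt ℂ (fun s => (Complex.Gamma s)⁻¹) s :=
    Complex.differentiable_one_div_Gamma.analyticAt s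
  rw [ha.meromorphicOrderAt_eq, ha.analyticOrderAt_eq_zero.2 (inv_ne_zero (Complex.Gamma_ne_zero hs))]
  rfl

/-- From `1 / Γ(s) = s / Γ(s + 1)`: the factor `s` gives the simple zero at `0`, and is a unit at
the other points, which reduce to their right neighbours. -/
lemma meromorphicOrderAt_inv_Gamma_neg_nat (n : ℕ) :
    meromorphicOrderAt (fun s => (Complex.Gamma s)⁻¹) (-(n : ℂ)) = 1 := by
  have hfun : (fun s => (Complex.Gamma s)⁻¹) = id * ((fun s => (Complex.Gamma s)⁻¹) ∘ (· + 1)) := by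
    ext s
    exact Complex.one_div_Gamma_eq_self_mul_one_div_Gamma_add_one s
  have ha : ∀ s, AnalyticAt ℂ ((fun s => (Complex.Gamma s)⁻¹) ∘ (· + 1)) s := fun s =>
    (Complex.differentiable_one_div_Gamma.comp (by fun_prop)).analyticAt s
  induction n with
  | zero =>
    rw [hfun, mul_comm, Nat.cast_zero, neg_zero,
      meromorphicOrderAt_mul_of_ne_zero (ha 0) (by simp), meromorphicOrderAt_id]
  | succ n ih =>
    have hne : (-((n + 1 : ℕ) : ℂ)) ≠ 0 := by
      rw [neg_ne_zero]
      exact_mod_cast Nat.succ_ne_zero n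
    rw [hfun, meromorphicOrderAt_mul_of_ne_zero analyticAt_id hne,
      meromorphicOrderAt_comp_add_const_eq_meromorphicOrderAt]
    have : -((n + 1 : ℕ) : ℂ) + 1 = -(n : ℂ) := by push_cast; ring
    rw [this]
    exact ih

lemma analyticAt_unitFactor (Ψ : ℝ) (p : ℕ) (s : ℂ) : AnalyticAt ℂ (unitFactor Ψ p) s := by
  have h1 : AnalyticAt ℂ (fun s : ℂ => (Complex.Gamma (p + 1 - s))⁻¹) s :=
    (Complex.differentiable_one_div_Gamma.comp
      (by fun_prop : Differentiable ℂ fun s : ℂ => (p : ℂ) + 1 - s)).analyticAt s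
  unfold unitFactor
  exact AnalyticAt.mul (by fun_prop) h1

lemma unitFactor_ne_zero (Ψ : ℝ) {p : ℕ} {s : ℂ} (hs : s.re < p + 1) : unitFactor Ψ p s ≠ 0 := by
  have h : Complex.Gamma (p + 1 - s) ≠ 0 :=
    Complex.Gamma_ne_zero_of_re_pos (by simp; linarith)
  exact mul_ne_zero (mul_ne_zero (Complex.exp_ne_zero _) (pow_ne_zero _ (by norm_num)))
    (inv_ne_zero h)

section

variable {α Ψ : ℝ} {m M N p : ℕ} {d : ℕ → ℕ → ℂ} {A : ℂ → ℂ} {s : ℂ}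

lemma natDegree_singularPoly_le (α Ψ : ℝ) (m M p : ℕ) (d : ℕ → ℕ → ℂ) (j : ℕ) :
    (singularPoly α Ψ m M p d j).natDegree ≤ M :=
  natDegree_logDerivOp_le _ _ (natDegree_rotPoly_le _ _ (by intro k h1 h2; omega))

lemma analyticAt_mellinSide (hA : AnalyticAt ℂ A s)
    (h : ∀ j ≤ N, singularPoly α Ψ m M p d j ≠ 0 → s ≠ expo α m j) :
    AnalyticAt ℂ (mellinSide α Ψ m M N p d A) s := by
  unfold mellinSide
  exact hA.fun_add (Finset.analyticAt_fun_sum _ fun j hj =>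
    analyticAt_polarPart M (h j (Nat.lt_succ_iff.1 (Finset.mem_range.1 hj))))

lemma meromorphicAt_mellinSide (hA : AnalyticAt ℂ A s) :
    MeromorphicAt (mellinSide α Ψ m M N p d A) s := by
  unfold mellinSide
  exact hA.meromorphicAt.fun_add (MeromorphicAt.fun_sum fun j _ => meromorphicAt_polarPart _ _ _ _)

lemma meromorphicAt_zetaContinuation (hA : AnalyticAt ℂ A s) :
    MeromorphicAt (zetaContinuation α Ψ m M N p d A) s := by
  unfold zetaContinuation
  exact (analyticAt_unitFactor Ψ p s).meromorphicAt.fun_mul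
    ((Complex.differentiable_one_div_Gamma.analyticAt s).meromorphicAt.fun_mul
      (meromorphicAt_mellinSide hA))

lemma analyticAt_zetaContinuation (hA : AnalyticAt ℂ A s)
    (h : ∀ j ≤ N, singularPoly α Ψ m M p d j ≠ 0 → s ≠ expo α m j) :
    AnalyticAt ℂ (zetaContinuation α Ψ m M N p d A) s := by
  unfold zetaContinuation
  exact (analyticAt_unitFactor Ψ p s).fun_mul
    ((Complex.differentiable_one_div_Gamma.analyticAt s).fun_mul (analyticAt_mellinSide hA h))

/-- Distinct exponents prevent polar parts from cancelling one another. -/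
lemma expo_injective (α : ℝ) {m : ℕ} (hm : 0 < m) : Function.Injective (expo α m) := by
  intro i j h
  have hm' : (m : ℝ) ≠ 0 := by exact_mod_cast hm.ne'
  simp only [expo] at h
  have h2 : (i : ℝ) / m = (j : ℝ) / m := by linarith
  rw [div_left_inj' hm'] at h2
  exact_mod_cast h2

/-- Splitting off the singular part of `mellinSide` at one of the exponents. -/
lemma mellinSide_eq_add (hm : 0 < m) {j : ℕ} (hj : j ≤ N)
    (hA : AnalyticAt ℂ A (expo α m j)) :
    ∃ B : ℂ → ℂ, AnalyticAt ℂ B (expo α m j) ∧ mellinSide α Ψ m M N p d A =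
      (fun s => polarPart (singularPoly α Ψ m M p d j) M (s - expo α m j)) + B := by
  refine ⟨fun s => A s + ∑ i ∈ (Finset.range (N + 1)).erase j,
    polarPart (singularPoly α Ψ m M p d i) M (s - expo α m i), ?_, ?_⟩
  · refine hA.fun_add (Finset.analyticAt_fun_sum _ fun i hi => analyticAt_polarPart M fun _ h => ?_)
    exact (Finset.mem_erase.1 hi).1 (expo_injective α hm (by exact_mod_cast h.symm))
  · ext s
    rw [mellinSide, ← Finset.add_sum_erase _ _ (Finset.mem_range.2 (Nat.lt_succ_of_le hj)),
      Pi.add_apply]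
    ring

lemma meromorphicOrderAt_mellinSide (hm : 0 < m) {j : ℕ} (hj : j ≤ N)
    (hA : AnalyticAt ℂ A (expo α m j)) {n : ℕ} (hn : (singularPoly α Ψ m M p d j).natDegree ≤ n)
    (hc : (singularPoly α Ψ m M p d j).coeff n ≠ 0) :
    meromorphicOrderAt (mellinSide α Ψ m M N p d A) (expo α m j) =
      ((-(n + 1 : ℕ) : ℤ) : WithTop ℤ) := by
  obtain ⟨B, hB, hEq⟩ := mellinSide_eq_add (Ψ := Ψ) (M := M) (p := p) (d := d) hm hj hA
  have hpol := meromorphicOrderAt_polarPart (natDegree_singularPoly_le α Ψ m M p d j) hn hc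
    (expo α m j : ℂ)
  rw [hEq, meromorphicOrderAt_add_eq_left_of_lt hB.meromorphicAt, hpol]
  rw [hpol]
  refine lt_of_lt_of_le ?_ hB.meromorphicOrderAt_nonneg
  rw [← WithTop.coe_zero, WithTop.coe_lt_coe]
  omega

lemma meromorphicOrderAt_zetaContinuation (hs : s.re < p + 1) (hA : AnalyticAt ℂ A s) :
    meromorphicOrderAt (zetaContinuation α Ψ m M N p d A) s =
      meromorphicOrderAt (fun s => (Complex.Gamma s)⁻¹) s +
        meromorphicOrderAt (mellinSide α Ψ m M N p d A) s := by
  have h1 := meromorphicOrderAt_mul_of_ne_zero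
    (f := (fun s => (Complex.Gamma s)⁻¹) * mellinSide α Ψ m M N p d A)
    (analyticAt_unitFactor Ψ p s) (unitFactor_ne_zero Ψ hs)
  rw [meromorphicOrderAt_mul
    (Complex.differentiable_one_div_Gamma.analyticAt s).meromorphicAt
    (meromorphicAt_mellinSide hA)] at h1
  exact h1

lemma singularPoly_eq_zero {j : ℕ} (hd : ∀ k ≤ M, d j k = 0) :
    singularPoly α Ψ m M p d j = 0 := by
  rw [singularPoly, rotPoly_eq_zero _ _ hd, map_zero]

/-- The order at an exponent that is not one of `0, …, p`. -/
lemma meromorphicOrderAt_mellinSide_of_ne (hm : 0 < m) {j : ℕ} (hj : j ≤ N)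
    (hA : AnalyticAt ℂ A (expo α m j)) {n : ℕ} (hnM : n ≤ M) (hd : d j n ≠ 0)
    (hd0 : ∀ k ≤ M, n < k → d j k = 0) (hne : ∀ i < p + 1, expo α m j ≠ (i : ℝ)) :
    meromorphicOrderAt (mellinSide α Ψ m M N p d A) (expo α m j) =
      ((-(n + 1 : ℕ) : ℤ) : WithTop ℤ) := by
  have hdeg := natDegree_rotPoly_le Ψ (expo α m j : ℂ) hd0
  refine meromorphicOrderAt_mellinSide hm hj hA (natDegree_logDerivOp_le _ _ hdeg)
    (coeff_logDerivOp_ne_zero (fun i hi h => hne i hi (by exact_mod_cast h)) hdeg ?_)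
  rw [coeff_rotPoly _ _ hd0, if_pos hnM]
  exact mul_ne_zero (Complex.exp_ne_zero _) hd

lemma singularPoly_eq_zero_of_natCast {i j : ℕ} (hi : i < p + 1) (h : expo α m j = (i : ℝ))
    (hd0 : ∀ k ≤ M, 0 < k → d j k = 0) : singularPoly α Ψ m M p d j = 0 := by
  rw [singularPoly, h, Complex.ofReal_natCast]
  exact logDerivOp_natCast_of_natDegree_eq_zero hi (natDegree_rotPoly_le _ _ hd0)

lemma natDegree_singularPoly_le_of_natCast {i j n : ℕ} (hi : i < p + 1)
    (h : expo α m j = (i : ℝ)) (hd0 : ∀ k ≤ M, n + 1 < k → d j k = 0) :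
    (singularPoly α Ψ m M p d j).natDegree ≤ n := by
  rw [singularPoly, h, Complex.ofReal_natCast]
  exact natDegree_logDerivOp_natCast_le hi (natDegree_rotPoly_le _ _ hd0)

/-- The order at one of the exponents `0, …, p`. -/
lemma meromorphicOrderAt_mellinSide_of_natCast (hm : 0 < m) {j : ℕ} (hj : j ≤ N)
    (hA : AnalyticAt ℂ A (expo α m j)) {n : ℕ} (hnM : n + 1 ≤ M) (hd : d j (n + 1) ≠ 0)
    (hd0 : ∀ k ≤ M, n + 1 < k → d j k = 0) {i : ℕ} (hi : i < p + 1) (h : expo α m j = (i : ℝ)) :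
    meromorphicOrderAt (mellinSide α Ψ m M N p d A) (expo α m j) =
      ((-(n + 1 : ℕ) : ℤ) : WithTop ℤ) := by
  refine meromorphicOrderAt_mellinSide hm hj hA (natDegree_singularPoly_le_of_natCast hi h hd0) ?_
  rw [singularPoly, h, Complex.ofReal_natCast]
  refine coeff_logDerivOp_natCast_ne_zero hi (natDegree_rotPoly_le _ _ hd0) ?_
  rw [coeff_rotPoly _ _ hd0, if_pos hnM]
  exact mul_ne_zero (Complex.exp_ne_zero _) hd

/-- The convention `Gamma 0 = 0` agrees with the zero of the entire function `1 / Γ` at `0`. -/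
lemma zetaContinuation_zero : zetaContinuation α Ψ m M N p d A 0 = 0 := by
  rw [zetaContinuation, Complex.Gamma_zero, inv_zero, zero_mul, mul_zero]

/-- When no squares of logarithms occur, the continuation has a removable singularity at an
exponent `0`. -/
lemma exists_zetaContinuation_eq_of_expo_eq_zero (hm : 0 < m) {j : ℕ} (hj : j ≤ N) (hM : M ≤ 1)
    (hA : AnalyticAt ℂ A 0) (h : expo α m j = 0) :
    ∃ G : ℂ → ℂ, AnalyticAt ℂ G 0 ∧ G 0 = (if M = 1 then d j 1 else 0) ∧
      zetaContinuation α Ψ m M N p d A =ᶠ[𝓝[≠] 0] G := by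
  have h0 : ((expo α m j : ℝ) : ℂ) = 0 := by rw [h, Complex.ofReal_zero]
  obtain ⟨B, hB, hEq⟩ := mellinSide_eq_add (Ψ := Ψ) (M := M) (p := p) (d := d) hm hj
    (by rw [h0]; exact hA)
  rw [h0] at hB
  have hd1 : ∀ k ≤ M, 1 < k → d j k = 0 := by intro k h1 h2; omega
  set c := (singularPoly α Ψ m M p d j).coeff 0 with hc
  have hcval : c = (-1) ^ p * p.factorial * if M = 1 then d j 1 else 0 := by
    rw [hc, singularPoly, h0, coeff_zero_logDerivOp_zero p (natDegree_rotPoly_le _ _ hd1),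
      coeff_rotPoly _ _ hd1, zero_mul, Complex.exp_zero, one_mul]
    congr 1
    exact if_congr (by omega) rfl rfl
  have hpol : ∀ s : ℂ, polarPart (singularPoly α Ψ m M p d j) M s = c / s := by
    intro s
    have hdeg : (singularPoly α Ψ m M p d j).natDegree ≤ 0 :=
      natDegree_singularPoly_le_of_natCast (i := 0) (Nat.succ_pos p) (by simpa using h) hd1
    rw [polarPart, Finset.sum_eq_single 0]
    · simp [hc, div_eq_mul_inv]
    · intro k _ hk
      rw [coeff_eq_zero_of_natDegree_lt (by omega), zero_mul]
    · simp
  -- The factor `s` of `1 / Γ(s) = s / Γ(s + 1)` absorbs the simple pole `c / s`.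
  refine ⟨fun s => unitFactor Ψ p s * ((Complex.Gamma (s + 1))⁻¹ * (c + s * B s)), ?_, ?_, ?_⟩
  · have hG : AnalyticAt ℂ (fun s : ℂ => (Complex.Gamma (s + 1))⁻¹) 0 :=
      (Complex.differentiable_one_div_Gamma.comp
        (by fun_prop : Differentiable ℂ fun s : ℂ => s + 1)).analyticAt 0
    exact (analyticAt_unitFactor Ψ p 0).fun_mul
      (hG.fun_mul (analyticAt_const.fun_add (analyticAt_id.fun_mul hB)))
  · have hpf : (p.factorial : ℂ) ≠ 0 := by exact_mod_cast p.factorial_ne_zero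
    have hsq : ((-1 : ℂ) ^ p) * (-1) ^ p = 1 := by
      rw [← mul_pow]; simp
    simp only [unitFactor, neg_zero, zero_mul, Complex.exp_zero, sub_zero, zero_add,
      Complex.Gamma_one, inv_one, one_mul, add_zero, hcval, Complex.Gamma_nat_eq_factorial]
    field_simp
    linear_combination (if M = 1 then d j 1 else 0) * hsq
  · filter_upwards [self_mem_nhdsWithin] with s hs
    have hs' : s ≠ 0 := hs
    rw [zetaContinuation, hEq, Pi.add_apply, h0, sub_zero, hpol,
      Complex.one_div_Gamma_eq_self_mul_one_div_Gamma_add_one s]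
    field_simp

end

end Orders

end SeqZeta

namespace SeqZeta

/-! ### Analyticity of the series, and meromorphic normal forms. -/

section Main

lemma ne_expo_of_lt_re {α : ℝ} {s : ℂ} (hs : α < s.re) (m j : ℕ) : s ≠ expo α m j := by
  rintro rfl
  rw [Complex.ofReal_re] at hs
  exact absurd (expo_le α m j) (not_le.2 hs)

lemma eventually_re_gt {x : ℝ} {s : ℂ} (hs : x < s.re) : ∀ᶠ z in 𝓝 s, x < z.re :=
  (isOpen_lt continuous_const Complex.continuous_re).mem_nhds hs

lemma eventually_re_lt {x : ℝ} {s : ℂ} (hs : s.re < x) : ∀ᶠ z in 𝓝 s, z.re < x :=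
  (isOpen_lt Complex.continuous_re continuous_const).mem_nhds hs

lemma analyticAt_of_differentiableOn_strip {A : ℂ → ℂ} {x y : ℝ}
    (hA : DifferentiableOn ℂ A {s | x < s.re ∧ s.re < y}) {s : ℂ} (h1 : x < s.re)
    (h2 : s.re < y) : AnalyticAt ℂ A s :=
  hA.analyticAt ((eventually_re_gt h1).and (eventually_re_lt h2))

/-- Each strip stops at `re s = p + 1`, so `p` is chosen depending on `s`; no exponent exceeds `α`.
-/
lemma analyticAt_zetaSeries {a : ℕ → ℂ} {α Ψ ε : ℝ} (ha : IsZetaSequence a α Ψ ε)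
    {F : ℂ → ℂ} (hF : IsCharacteristicFunction F a α) {m M N : ℕ} {δ : ℝ} (hδ : 0 < δ)
    (hκ : expo α m N - δ < 0) {d : ℕ → ℕ → ℂ} (hd : HasLogExpansion F α Ψ ε m M N δ d) {s : ℂ}
    (hs : α < s.re) : AnalyticAt ℂ (zetaSeries a Ψ) s := by
  obtain ⟨p, hp⟩ := exists_nat_gt s.re
  obtain ⟨A, hA, hAeq⟩ := exists_zeta_continuation ha hF hκ hd (p := p) (by linarith)
  have hAs : AnalyticAt ℂ A s :=
    analyticAt_of_differentiableOn_strip hA (by linarith [expo_le α m N]) (by linarith)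
  refine (analyticAt_zetaContinuation (α := α) (Ψ := Ψ) (m := m) (M := M) (N := N) (p := p) (d := d)
    hAs fun j _ _ => ne_expo_of_lt_re hs m j).congr ?_
  filter_upwards [eventually_re_gt hs, eventually_re_lt (x := p + 1) (by linarith)] with z h1 h2
  exact (hAeq z h1 h2).symm

lemma MeromorphicNFAt.hasPoleOfOrder {Z : ℂ → ℂ} {s : ℂ} (hZ : MeromorphicNFAt Z s) {n : ℕ}
    (h : meromorphicOrderAt Z s = ((-(n : ℤ) : ℤ) : WithTop ℤ)) : HasPoleOfOrder Z s n := by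
  rw [HasPoleOfOrder]
  split_ifs with hn
  · rw [← hZ.meromorphicOrderAt_nonneg_iff_analyticAt, h, hn]
    simp
  · exact h

/-- Normal form excludes wrong values at removable singularities, so agreement near a point extends
to the point. -/
lemma MeromorphicNFAt.eq_of_eventuallyEq {Z G : ℂ → ℂ} {s : ℂ} (hZ : MeromorphicNFAt Z s)
    (hG : AnalyticAt ℂ G s) (h : Z =ᶠ[𝓝[≠] s] G) : AnalyticAt ℂ Z s ∧ Z s = G s := by
  have h' := (hZ.eventuallyEq_nhdsNE_iff_eventuallyEq_nhds hG.meromorphicNFAt).1 h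
  exact ⟨hG.congr h'.symm, h'.eq_of_nhds⟩

end Main

end SeqZeta

/-! ### Gluing, and reading off the singularities. -/

theorem mainTheorem4 (a : ℕ → ℂ) (α Ψ ε : ℝ) (ha : SeqZeta.IsZetaSequence a α Ψ ε)
    (F : ℂ → ℂ) (hF : SeqZeta.IsCharacteristicFunction F a α)
    (m M N : ℕ) (δ : ℝ) (hm : 0 < m) (hδ : 0 < δ) (hN : α - δ < (N : ℝ) / (m : ℝ))
    (d : ℕ → ℕ → ℂ) (hd : SeqZeta.HasLogExpansion F α Ψ ε m M N δ d) :
    ∃ Z : ℂ → ℂ,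
      -- `Z` is a meromorphic continuation of the zeta series
      MeromorphicOn Z {s : ℂ | SeqZeta.expo α m N - δ < s.re} ∧
      (∀ s : ℂ, α < s.re →
        Summable (fun n => SeqZeta.zetaTerm Ψ s (a n)) ∧ Z s = SeqZeta.zetaSeries a Ψ s) ∧
      -- all its singularities are exponents that really occur in the expansion
      (∀ s : ℂ, SeqZeta.expo α m N - δ < s.re →
        (∀ j ≤ N, ∀ k ≤ M, d j k ≠ 0 → s ≠ (SeqZeta.expo α m j : ℂ)) → AnalyticAt ℂ Z s) ∧
      -- the order of the pole at a nonzero exponent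
      (∀ j ≤ N, ∀ kbar ≤ M, d j kbar ≠ 0 → (∀ k ≤ M, kbar < k → d j k = 0) →
        ((∀ q : ℤ, SeqZeta.expo α m j ≠ (q : ℝ)) →
          SeqZeta.HasPoleOfOrder Z (SeqZeta.expo α m j : ℂ) (kbar + 1)) ∧
        ((∃ q : ℤ, q ≠ 0 ∧ SeqZeta.expo α m j = (q : ℝ)) →
          SeqZeta.HasPoleOfOrder Z (SeqZeta.expo α m j : ℂ) kbar)) ∧
      -- the point `0` when `M ≤ 1`
      (M ≤ 1 → AnalyticAt ℂ Z 0 ∧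
        ((∀ j ≤ N, SeqZeta.expo α m j ≠ 0) → Z 0 = 0) ∧
        (∀ j ≤ N, SeqZeta.expo α m j = 0 → Z 0 = if M = 1 then d j 1 else 0)) ∧
      -- the point `0` when `M ≥ 2`
      (2 ≤ M → (∃ n ≤ M - 1, SeqZeta.HasPoleOfOrder Z 0 n) ∧
        (∀ j ≤ N, SeqZeta.expo α m j = 0 → d j M ≠ 0 →
          SeqZeta.HasPoleOfOrder Z 0 (M - 1))) := by
  have hκ : SeqZeta.expo α m N - δ < 0 := by
    rw [SeqZeta.expo]
    linarith
  -- All exponents are at most `α < p`, so a nonnegative integer exponent is one of `0, …, p`.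
  obtain ⟨p, hp⟩ := exists_nat_gt α
  obtain ⟨A, hA, hAeq⟩ := SeqZeta.exists_zeta_continuation ha hF hκ hd (p := p) (by linarith)
  have hα := ha.exponent_nonneg
  set κ := SeqZeta.expo α m N - δ with hκdef
  set U : Set ℂ := {s | κ < s.re} with hU
  set G := SeqZeta.zetaContinuation α Ψ m M N p d A with hG
  -- The formula `G` serves only for `re s < p + 1`; further right the series takes over, and both
  -- agree on the overlap.
  set g : ℂ → ℂ := fun s => if α < s.re then SeqZeta.zetaSeries a Ψ s else G s with hg
  have hAn : ∀ s : ℂ, κ < s.re → s.re < p + 1 → AnalyticAt ℂ A s := fun s h1 h2 =>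
    SeqZeta.analyticAt_of_differentiableOn_strip hA h1 h2
  have hgG : ∀ s : ℂ, s.re < p + 1 → g =ᶠ[𝓝 s] G := by
    intro s hs
    filter_upwards [SeqZeta.eventually_re_lt hs] with z hz
    simp only [hg]
    split_ifs with h
    · exact hAeq z h hz
    · rfl
  have hgζ : ∀ s : ℂ, α < s.re → g =ᶠ[𝓝 s] SeqZeta.zetaSeries a Ψ := by
    intro s hs
    filter_upwards [SeqZeta.eventually_re_gt hs] with z hz
    simp only [hg, if_pos hz]
  have hgm : MeromorphicOn g U := by
    intro s hs
    rcases lt_or_ge α s.re with h | h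
    · exact (SeqZeta.analyticAt_zetaSeries ha hF hδ hκ hd h).meromorphicAt.congr
        ((hgζ s h).symm.filter_mono nhdsWithin_le_nhds)
    · exact (SeqZeta.meromorphicAt_zetaContinuation (hAn s hs (by linarith))).congr
        ((hgG s (by linarith)).symm.filter_mono nhdsWithin_le_nhds)
  set Z := toMeromorphicNFOn g U with hZ
  have hNF : ∀ s ∈ U, MeromorphicNFAt Z s := fun s hs => meromorphicNFOn_toMeromorphicNFOn g U hs
  have hZg : ∀ s ∈ U, Z =ᶠ[𝓝[≠] s] g := fun s hs => hgm.toMeromorphicNFOn_eq_self_on_nhdsNE hs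
  have hZG : ∀ s ∈ U, s.re < p + 1 → Z =ᶠ[𝓝[≠] s] G := fun s hs h =>
    (hZg s hs).trans ((hgG s h).filter_mono nhdsWithin_le_nhds)
  have hZζ : ∀ s : ℂ, α < s.re → AnalyticAt ℂ Z s ∧ Z s = SeqZeta.zetaSeries a Ψ s := by
    intro s hs
    have hsU : s ∈ U := by
      have := SeqZeta.expo_le α m N
      change κ < s.re
      linarith
    exact SeqZeta.MeromorphicNFAt.eq_of_eventuallyEq (hNF s hsU)
      (SeqZeta.analyticAt_zetaSeries ha hF hδ hκ hd hs)
      ((hZg s hsU).trans ((hgζ s hs).filter_mono nhdsWithin_le_nhds))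
  have hexpoU : ∀ j ≤ N, ((SeqZeta.expo α m j : ℝ) : ℂ) ∈ U := by
    intro j hj
    have h1 : (j : ℝ) / m ≤ (N : ℝ) / m := by gcongr
    simp only [hU, Set.mem_ofPred_eq, Complex.ofReal_re, hκdef, SeqZeta.expo]
    linarith
  have hexpolt : ∀ j, ((SeqZeta.expo α m j : ℝ) : ℂ).re < p + 1 := by
    intro j
    rw [Complex.ofReal_re]
    linarith [SeqZeta.expo_le α m j]
  have h0U : (0 : ℂ) ∈ U := by simpa [hU] using hκ
  have h0lt : (0 : ℂ).re < p + 1 := by rw [Complex.zero_re]; linarith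
  have hregular : ∀ s ∈ U, s.re < p + 1 →
      (∀ j ≤ N, SeqZeta.singularPoly α Ψ m M p d j ≠ 0 → s ≠ SeqZeta.expo α m j) →
      AnalyticAt ℂ Z s ∧ Z s = G s := fun s hs hlt h =>
    SeqZeta.MeromorphicNFAt.eq_of_eventuallyEq (hNF s hs)
      (SeqZeta.analyticAt_zetaContinuation (hAn s hs hlt) h) (hZG s hs hlt)
  have horder : ∀ s ∈ U, s.re < p + 1 → meromorphicOrderAt Z s =
      meromorphicOrderAt (fun s => (Complex.Gamma s)⁻¹) s +
        meromorphicOrderAt (SeqZeta.mellinSide α Ψ m M N p d A) s := fun s hs hlt => by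
    rw [meromorphicOrderAt_congr (hZG s hs hlt),
      SeqZeta.meromorphicOrderAt_zetaContinuation hlt (hAn s hs hlt)]
  have hpole0 : ∀ s ∈ U, AnalyticAt ℂ Z s → SeqZeta.HasPoleOfOrder Z s 0 := fun s _ h => by
    rwa [SeqZeta.HasPoleOfOrder, if_pos rfl]
  -- The simple zero of `1 / Γ` at `0` reduces the order `n + 1` to `n`.
  have hzero_pole : ∀ j ≤ N, SeqZeta.expo α m j = 0 → ∀ n : ℕ,
      (SeqZeta.singularPoly α Ψ m M p d j).natDegree ≤ n →
      (SeqZeta.singularPoly α Ψ m M p d j).coeff n ≠ 0 → SeqZeta.HasPoleOfOrder Z 0 n := by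
    intro j hj h n hn hc
    have h0 : ((SeqZeta.expo α m j : ℝ) : ℂ) = 0 := by rw [h, Complex.ofReal_zero]
    have h1 := SeqZeta.meromorphicOrderAt_mellinSide hm hj
      (by rw [h0]; exact hAn 0 h0U h0lt) hn hc
    have h2 := SeqZeta.meromorphicOrderAt_inv_Gamma_neg_nat 0
    rw [Nat.cast_zero, neg_zero] at h2
    rw [h0] at h1
    refine SeqZeta.MeromorphicNFAt.hasPoleOfOrder (hNF 0 h0U) ?_
    rw [horder 0 h0U h0lt, h1, h2, ← WithTop.coe_one, ← WithTop.coe_add]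
    congr 1
    push_cast
    ring
  refine ⟨Z, fun s hs => (hNF s hs).meromorphicAt, fun s hs =>
    ⟨SeqZeta.summable_zetaTerm ha hs, (hZζ s hs).2⟩, ?_, ?_, ?_, ?_⟩
  · intro s hs hne
    rcases lt_or_ge α s.re with h | h
    · exact (hZζ s h).1
    · refine (hregular s hs (by linarith) fun j hj hP => ?_).1
      by_contra hse
      exact hP (SeqZeta.singularPoly_eq_zero fun k hk => by_contra fun hdk =>
        hne j hj k hk hdk hse)
  · intro j hj kbar hkM hdk hd0
    have hjU := hexpoU j hj
    have hjlt := hexpolt j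
    have hAj := hAn _ hjU hjlt
    constructor
    · intro hnot
      refine SeqZeta.MeromorphicNFAt.hasPoleOfOrder (hNF _ hjU) ?_
      rw [horder _ hjU hjlt, SeqZeta.meromorphicOrderAt_inv_Gamma_of_ne,
        SeqZeta.meromorphicOrderAt_mellinSide_of_ne hm hj hAj hkM hdk hd0
          (fun i _ => by simpa using hnot i), zero_add]
      intro n h
      refine hnot (-(n : ℤ)) ?_
      push_cast
      exact_mod_cast h
    · rintro ⟨r, hr0, hr⟩
      rcases lt_or_gt_of_ne hr0 with hneg | hpos
      -- At a negative integer the degree is kept and `1 / Γ` removes one order.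
      · obtain ⟨n, rfl⟩ : ∃ n : ℕ, r = -(n : ℤ) := ⟨r.natAbs, by omega⟩
        have hval : ((SeqZeta.expo α m j : ℝ) : ℂ) = -(n : ℂ) := by rw [hr]; push_cast; rfl
        refine SeqZeta.MeromorphicNFAt.hasPoleOfOrder (hNF _ hjU) ?_
        have hΓ := SeqZeta.meromorphicOrderAt_inv_Gamma_neg_nat n
        rw [← hval] at hΓ
        rw [horder _ hjU hjlt, hΓ,
          SeqZeta.meromorphicOrderAt_mellinSide_of_ne hm hj hAj hkM hdk hd0
          (fun i _ h => by
            rw [hr] at h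
            have : (-(n : ℤ)) = (i : ℤ) := by exact_mod_cast h
            omega), ← WithTop.coe_one, ← WithTop.coe_add]
        congr 1
        push_cast
        ring
      -- At a positive integer `1 / Γ` is a unit, but the degree drops by one; for `kbar = 0` the
      -- polynomial disappears.
      · obtain ⟨i, rfl⟩ : ∃ i : ℕ, r = (i : ℤ) := ⟨r.natAbs, by omega⟩
        have hval : SeqZeta.expo α m j = (i : ℝ) := by rw [hr]; push_cast; rfl
        have hi : i < p + 1 := by
          have h1 := SeqZeta.expo_le α m j
          rw [hval] at h1
          have : (i : ℝ) < p := by linarith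
          have : i < p := by exact_mod_cast this
          omega
        rcases Nat.eq_zero_or_pos kbar with rfl | hk
        · refine hpole0 _ hjU (hregular _ hjU hjlt fun l _ hP hEq => ?_).1
          have : j = l := SeqZeta.expo_injective α hm (by exact_mod_cast hEq)
          subst this
          exact hP (SeqZeta.singularPoly_eq_zero_of_natCast hi hval hd0)
        · obtain ⟨n, rfl⟩ : ∃ n, kbar = n + 1 := ⟨kbar - 1, by omega⟩
          refine SeqZeta.MeromorphicNFAt.hasPoleOfOrder (hNF _ hjU) ?_
          rw [horder _ hjU hjlt, SeqZeta.meromorphicOrderAt_inv_Gamma_of_ne,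
            SeqZeta.meromorphicOrderAt_mellinSide_of_natCast hm hj hAj hkM hdk hd0 hi hval,
            zero_add]
          intro l h
          rw [hval] at h
          have : (i : ℤ) = -(l : ℤ) := by exact_mod_cast h
          omega
  · intro hM
    by_cases hex : ∃ j ≤ N, SeqZeta.expo α m j = 0
    · obtain ⟨j, hj, hj0⟩ := hex
      obtain ⟨H, hH, hH0, hHG⟩ := SeqZeta.exists_zetaContinuation_eq_of_expo_eq_zero (Ψ := Ψ)
        (d := d) hm hj hM (hAn 0 h0U h0lt) hj0
      have hres := SeqZeta.MeromorphicNFAt.eq_of_eventuallyEq (hNF 0 h0U) hH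
        ((hZG 0 h0U h0lt).trans hHG)
      refine ⟨hres.1, fun hno => absurd hj0 (hno j hj), fun l _ hl0 => ?_⟩
      have : l = j := SeqZeta.expo_injective α hm (hl0.trans hj0.symm)
      rw [this, hres.2, hH0]
    · have hno : ∀ j ≤ N, SeqZeta.expo α m j ≠ 0 := fun j hj h => hex ⟨j, hj, h⟩
      have hres := hregular 0 h0U h0lt fun j hj _ h => hno j hj (by exact_mod_cast h.symm)
      refine ⟨hres.1, fun _ => ?_, fun j hj h => absurd h (hno j hj)⟩
      rw [hres.2, hG, SeqZeta.zetaContinuation_zero]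
  · intro hM
    have hdeg : ∀ j, SeqZeta.expo α m j = 0 →
        (SeqZeta.singularPoly α Ψ m M p d j).natDegree ≤ M - 1 := fun j h =>
      SeqZeta.natDegree_singularPoly_le_of_natCast (i := 0) (Nat.succ_pos p) (by simpa using h)
        (by intro k h1 h2; omega)
    constructor
    · by_cases hex : ∃ j ≤ N, SeqZeta.expo α m j = 0 ∧ SeqZeta.singularPoly α Ψ m M p d j ≠ 0
      · obtain ⟨j, hj, hj0, hP⟩ := hex
        -- The order is the actual degree of the polynomial, which can be smaller than `M - 1`.
        exact ⟨_, hdeg j hj0, hzero_pole j hj hj0 _ le_rfl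
          (Polynomial.leadingCoeff_ne_zero.2 hP)⟩
      · refine ⟨0, Nat.zero_le _, hpole0 0 h0U (hregular 0 h0U h0lt fun j hj hP h => ?_).1⟩
        exact hex ⟨j, hj, by exact_mod_cast h.symm, hP⟩
    · intro j hj hj0 hdM
      refine hzero_pole j hj hj0 _ (hdeg j hj0) ?_
      obtain ⟨n, rfl⟩ : ∃ n, M = n + 1 := ⟨M - 1, by omega⟩
      have hd0 : ∀ k ≤ n + 1, n + 1 < k → d j k = 0 := by intro k h1 h2; omega
      have hcast : ((SeqZeta.expo α m j : ℝ) : ℂ) = ((0 : ℕ) : ℂ) := by rw [hj0]; simp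
      rw [Nat.add_sub_cancel, SeqZeta.singularPoly, hcast]
      refine SeqZeta.coeff_logDerivOp_natCast_ne_zero (Nat.succ_pos p)
        (SeqZeta.natDegree_rotPoly_le _ _ hd0) ?_
      rw [SeqZeta.coeff_rotPoly _ _ hd0, if_pos le_rfl]
      exact mul_ne_zero (Complex.exp_ne_zero _) hdM
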